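/- **Setting.** Let $\mathcal X$ and $\Theta$ be standard Borel spaces (e.g. Borel subsets of $\mathbb R^d$, $\mathbb R^p$), $\mathcal Z=\{-1,1\}$, $\mathcal Y=\{0,1\}$. There are $n$ source domains $s\in\mathcal E_s=\{1,\dots,n\}$, each a probability distribution $\mathbb P^s$ of $(X,Z,Y)$ on $\mathcal X\times\mathcal Z\times\mathcal Y$ with $p^s=\mathbb P^s(Z=1)\in(0,1)$, and a measurable transformation model $T(\cdot,\cdot,s):\mathcal X\times\mathcal Z\to\mathcal X\times\mathcal Z$ for each $s$. $\mathcal F$ is a convex set of measurable classifiers $f:\mathcal X\to[0,1]$ (labels relaxed to their convex hull), and $\hat f:\mathcal X\times\Theta\to[0,1]$ is jointly measurable with $\{\hat f(\cdot,\theta):\theta\in\Theta\}\subseteq\mathcal F$. For $f\in\mathcal F$ put $$R(f)=\sum_s w_s\,\mathbb E_{\mathbb P^s}\,\ell(f(X),Y),\qquad \delta^{i,j}(f)=\mathbb E_{\mathbb P^i}\,d[f(X),f(X')]\ \text{ with }(X',Z')=T(X,Z,j),$$ $$\rho^s(f)=\big|\mathbb E_{\mathbb P^s}\,g_s(f(X),Z)\big|,\qquad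 g_s(\hat y,z)=\tfrac{1}{p^s(1-p^s)}\Big(\tfrac{z+1}{2}-p^s\Big)\hat y,$$ where $w$ is a fixed probability vector on the source domains (a point mass, or uniform weights for the pooled distribution). Define $$P^\star=\inf\{R(f): f\in\mathcal F,\ f(X)=f(X')\ \mathbb P^i\text{-a.s. and }\rho^i(f)=\rho^j(f)=0\text{ for all }i\ne j\},$$ $$P^\star(\gamma_1,\gamma_2)=\inf\{R(f): f\in\mathcal F,\ \delta^{i,j}(f)\le\gamma_1\text{ and }\rho^i(f)+\rho^j(f)\le\gamma_2\text{ for all }i\ne j\}.$$ From $M$ i.i.d. data from each source domain (independent across domains), let $\hat R(\theta),\hat\delta^{i,j}(\theta),\hat\rho^{s}(\theta)$ be the empirical counterparts of $R,\delta^{i,j},\rho^s$ at $\hat f(\cdot,\theta)$, obtained by replacing each $\mathbb E_{\mathbb P^s}$ by a sample mean, and let $$D^\star_{\xi,M,\mathcal E_s}(\boldsymbol\gamma)=\sup_{\lambda_1,\lambda_2\ge0}\ \inf_{\theta\in\Theta}\ \hat R(\theta)+\frac1n\sum_{i\ne j}\Big[\lambda_1(i,j)\big(\hat\delta^{i,j}(\theta)-\gamma_1\big)+\lambda_2(i,j)\big(\hat\rho^i(\theta)+\hat\rho^j(\theta)-\gamma_2\big)\Big],$$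 the sum being over ordered pairs of distinct source domains. **Assumptions.** Let $\xi,\gamma_1,\gamma_2,L_\ell,L_d,L_g>0$ and $k=\max\{L_\ell,L_d,L_g\}$. 1. ($\xi$-parameterization) For each $f\in\mathcal F$ there is $\theta\in\Theta$ with $\mathbb E_{\mathbb P^s}|\hat f(X,\theta)-f(X)|\le\xi$ for every source domain $s$. 2. For $y\in\mathcal Y$, $\ell(\cdot,y)$ is convex on $[0,1]$, has values in $[0,B]$ and is $L_\ell$-Lipschitz. 3. $d$ is measurable, convex on $[0,1]^2$, has values in $[0,B]$ there, and $d[a,b]=0$ iff $a=b$. For all $f_1,f_2\in\mathcal F$: with $x'$ the first component of $T(x,z,s)$, $\big|d[f_1(x),f_1(x')]-d[f_2(x),f_2(x')]\big|\le L_d\big(|f_1(x)-f_2(x)|+|f_1(x')-f_2(x')|\big)$ for all $x,z,s$, and $|\delta^{i,j}(f_1)-\delta^{i,j}(f_2)|\le L_d\,\mathbb E_{\mathbb P^i}|f_1(X)-f_2(X)|$ for $i\neq j$. (Both hold if $|d[f_1(x),f_1(x')]-d[f_2(x),f_2(x')]|\le L_d|f_1(x)-f_2(x)|$ always.) 4.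 For each $s,z$, $g_s(\cdot,z)$ is bounded by $B$ in absolute value and $L_g$-Lipschitz on $[0,1]$. 5. (Strict feasibility) For some $\theta\in\Theta$ and $\eta>0$, with $f=\hat f(\cdot,\theta)$: $\delta^{i,j}(f)\le\gamma_1-\xi\max\{L_\ell,L_d\}-\eta$ and $\rho^i(f)+\rho^j(f)\le\gamma_2-\xi\max\{L_\ell,L_g\}-\eta$ for all $i\ne j$. 6. $P^\star(\cdot,\cdot)$ is finite and $L$-Lipschitz for the $\ell^1$ norm on $[0,\infty)^2$. 7. $\{\hat f(\cdot,\theta):\theta\in\Theta\}$ has VC dimension at most $V<\infty$, i.e. its subgraphs $\{(x,t):t<\hat f(x,\theta)\}$ shatter no set of more than $V$ points (for $\{0,1\}$-valued functions this is the usual VC dimension). Call $\boldsymbol\lambda^\star_p\ge0$ an optimal dual variable of the perturbed problem if it maximizes over $\lambda_1,\lambda_2\ge0$ the dual function $$\inf_{f\in\mathcal F}R(f)+\frac1n\sum_{i\ne j}\Big[\lambda_1(i,j)\big(\delta^{i,j}(f)-(\gamma_1-\xi k)\big)+\lambda_2(i,j)\big(\rho^i(f)+\rho^j(f)-(\gamma_2-2\xi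 k)\big)\Big],$$ in which each of the constraints $\delta^{i,j}\le\gamma_1$, $\rho^i\le\gamma_2/2$, $\rho^j\le\gamma_2/2$ is tightened by $\xi k$. **Theorem.** For every $\omega\in(0,1)$ there are constants $C,M_0$, depending only on $n,V,B,L_\ell,L_d,L_g,\eta,\omega$, such that under the assumptions above the following holds. If some $f\in\mathcal F$ satisfies $\delta^{i,j}(f)<\gamma_1-\xi k$ and $\rho^i(f)+\rho^j(f)<\gamma_2-2\xi k$ for all $i\neq j$, then an optimal dual variable of the perturbed problem exists. For every optimal dual variable $\boldsymbol\lambda^\star_p$ of the perturbed problem and every $M\ge M_0$, with probability at least $1-\omega$ over the samples, $P^\star$ and $D^\star_{\xi,M,\mathcal E_s}(\boldsymbol\gamma)$ are finite and $$\big|P^\star-D^\star_{\xi,M,\mathcal E_s}(\boldsymbol\gamma)\big|\le L\|\boldsymbol\gamma\|_1+\xi k\,\big(1+\|\boldsymbol\lambda^\star_p\|_1\big)+C\sqrt{\frac{\log M}{M}},$$ where $\|\boldsymbol\gamma\|_1=\gamma_1+\gamma_2$ and $\|\boldsymbol\lambda\|_1=\sum_{i\ne j}(|\lambda_1(i,j)|+|\lambda_2(i,j)|)$.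 -/

import Mathlib

open MeasureTheory Set

noncomputable section

/-- The sensitive space `{-1, 1}`. -/
abbrev Sens : Type := ({-1, 1} : Set ℤ)

/-- The label space `{0, 1}`. -/
abbrev Lab : Type := Fin 2

/-- A datum `(x, z, y)`: features, sensitive attribute, label. -/
abbrev Datum (X : Type*) : Type _ := X × Sens × Lab

/-- The fairness function `g(ŷ, z) = (1 / (p (1 - p))) ((z + 1) / 2 - p) ŷ`, where `p` is the
proportion of the subgroup `z = 1`. -/
def fairG (p a : ℝ) (z : Sens) : ℝ := 1 / (p * (1 - p)) * (((z : ℤ) + 1 : ℝ) / 2 - p) * a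

/-- The data of the learning problem with `n` source domains. -/
structure FairDG (n : ℕ) (X Θ : Type*) [MeasurableSpace X] where
  /-- joint distribution of features, sensitive attribute and label in each source domain -/
  P : Fin n → Measure (Datum X)
  /-- weights of the source domains in the risk -/
  w : Fin n → ℝ
  /-- transformation model: `T x z s` moves `(x, z)` to the domain `s` -/
  T : X → Sens → Fin n → X × Sens
  /-- loss `ℓ(prediction, label)` -/
  loss : ℝ → Lab → ℝ
  /-- distance between predictions -/
  d : ℝ → ℝ → ℝ
  /-- class of classifiers -/
  F : Set (X → ℝ)
  /-- parameterized classifier -/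
  fhat : X → Θ → ℝ

/-- A finite set of points `(x, t)` is shattered by the class `A` (through subgraphs). For
`{0, 1}`-valued classes and `t ∈ [0, 1)` this is shattering of points `x` in the usual sense. -/
def SubgraphShatters {X : Type*} (A : Set (X → ℝ)) (S : Finset (X × ℝ)) : Prop :=
  ∀ U ⊆ S, ∃ f ∈ A, ∀ q ∈ S, q.2 < f q.1 ↔ q ∈ U

/-- The VC dimension of the class `A` of real functions (of their subgraphs) is at most `V`. -/
def VCDimLE {X : Type*} (A : Set (X → ℝ)) (V : ℕ) : Prop :=
  ∀ S : Finset (X × ℝ), SubgraphShatters A S → S.card ≤ V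

/-- The Lagrangian `R + (1/n) ∑_{i ≠ j} [λ₁(i,j) (δ(i,j) - γ₁) + λ₂(i,j) (ρ(i) + ρ(j) - γ₂)]`. -/
def lagr {n : ℕ} (R : ℝ) (δ : Fin n → Fin n → ℝ) (ρ : Fin n → ℝ) (γ₁ γ₂ : ℝ)
    (l₁ l₂ : Fin n → Fin n → ℝ) : ℝ :=
  R + 1 / (n : ℝ) * ∑ q ∈ (Finset.univ : Finset (Fin n)).offDiag,
    (l₁ q.1 q.2 * (δ q.1 q.2 - γ₁) + l₂ q.1 q.2 * (ρ q.1 + ρ q.2 - γ₂))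

/-- Dual variables `λ = (λ₁(i,j), λ₂(i,j))` are nonnegative. -/
def DualNonneg {n : ℕ} (l₁ l₂ : Fin n → Fin n → ℝ) : Prop :=
  ∀ i j, 0 ≤ l₁ i j ∧ 0 ≤ l₂ i j

/-- The `ℓ¹` norm of the dual variables, over ordered pairs of distinct domains. -/
def dualNorm {n : ℕ} (l₁ l₂ : Fin n → Fin n → ℝ) : ℝ :=
  ∑ q ∈ (Finset.univ : Finset (Fin n)).offDiag, (|l₁ q.1 q.2| + |l₂ q.1 q.2|)

/-- Both optimal values are finite and they differ by at most `c`. -/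
def GapAtMost (u v : EReal) (c : ℝ) : Prop :=
  ∃ a b : ℝ, u = (a : EReal) ∧ v = (b : EReal) ∧ |a - b| ≤ c

namespace FairDG

variable {n : ℕ} {X Θ : Type*} [MeasurableSpace X] (D : FairDG n X Θ)

/-- Proportion of the subgroup `z = 1` in domain `s`. -/
def p₁ (s : Fin n) : ℝ := (D.P s).real {q | (q.2.1 : ℤ) = 1}

/-- The parameterized class `A_ξ = {f̂(·, θ) : θ ∈ Θ}`. -/
def paramClass : Set (X → ℝ) := Set.range fun θ x => D.fhat x θ

/-- Risk. -/
def R (f : X → ℝ) : ℝ := ∑ s, D.w s * ∫ q, D.loss (f q.1) q.2.2 ∂(D.P s)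

/-- `δ^{i,j}(f) = E_{P^i} d[f(X), f(X')]` where `(X', Z') = T(X, Z, j)`. -/
def δ (f : X → ℝ) (i j : Fin n) : ℝ :=
  ∫ q, D.d (f q.1) (f (D.T q.1 q.2.1 j).1) ∂(D.P i)

/-- `ρ^s(f) = |E_{P^s} g(f(X), Z)|`. -/
def ρ (f : X → ℝ) (s : Fin n) : ℝ :=
  |∫ q, fairG (D.p₁ s) (f q.1) q.2.1 ∂(D.P s)|

/-- `f` satisfies the exact constraints: invariance under `T` and zero unfairness. -/
def Invariant (f : X → ℝ) : Prop :=
  ∀ i j, i ≠ j →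
    (∀ᵐ q ∂(D.P i), f q.1 = f (D.T q.1 q.2.1 j).1) ∧ D.ρ f i = 0 ∧ D.ρ f j = 0

/-- The optimal value `P⋆` of the exact problem. -/
def Pstar : EReal := ⨅ f ∈ D.F, ⨅ _ : D.Invariant f, (D.R f : EReal)

/-- The constraints relaxed to the levels `γ₁, γ₂`. -/
def Feasible (γ₁ γ₂ : ℝ) (f : X → ℝ) : Prop :=
  ∀ i j, i ≠ j → D.δ f i j ≤ γ₁ ∧ D.ρ f i + D.ρ f j ≤ γ₂

/-- The perturbation function `P⋆(γ₁, γ₂)`. -/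
def pert (γ₁ γ₂ : ℝ) : EReal := ⨅ f ∈ D.F, ⨅ _ : D.Feasible γ₁ γ₂ f, (D.R f : EReal)

/-- `P⋆(γ₁, γ₂)` is finite and `L`-Lipschitz (for the `ℓ¹` norm) on `γ₁, γ₂ ≥ 0`. -/
def PertLipschitz (L : ℝ) : Prop :=
  ∃ p : ℝ → ℝ → ℝ, (∀ a b, 0 ≤ a → 0 ≤ b → D.pert a b = (p a b : EReal)) ∧
    ∀ a b a' b', 0 ≤ a → 0 ≤ b → 0 ≤ a' → 0 ≤ b' →
      |p a b - p a' b'| ≤ L * (|a - a'| + |b - b'|)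

/-- Dual function, over the class `F`, of the problem with constraint levels `γ₁, γ₂`. -/
def dualFun (γ₁ γ₂ : ℝ) (l₁ l₂ : Fin n → Fin n → ℝ) : EReal :=
  ⨅ f ∈ D.F, (lagr (D.R f) (D.δ f) (D.ρ f) γ₁ γ₂ l₁ l₂ : EReal)

/-- `(l₁, l₂)` is an optimal dual variable of the problem with constraint levels `γ₁, γ₂`. -/
def IsOptimalDual (γ₁ γ₂ : ℝ) (l₁ l₂ : Fin n → Fin n → ℝ) : Prop :=
  DualNonneg l₁ l₂ ∧
    ∀ m₁ m₂, DualNonneg m₁ m₂ → D.dualFun γ₁ γ₂ m₁ m₂ ≤ D.dualFun γ₁ γ₂ l₁ l₂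

/-- The law of samples of `M` i.i.d. data from each source domain, independent across domains. -/
def sampleLaw (M : ℕ) : Measure (Fin n → Fin M → Datum X) :=
  Measure.pi fun s => Measure.pi fun _ => D.P s

/-- Empirical counterpart of `R(f̂(·, θ))`. -/
def empR {M : ℕ} (S : Fin n → Fin M → Datum X) (θ : Θ) : ℝ :=
  ∑ s, D.w s * (1 / (M : ℝ) * ∑ m, D.loss (D.fhat (S s m).1 θ) (S s m).2.2)

/-- Empirical counterpart of `δ^{i,j}(f̂(·, θ))`. -/
def empδ {M : ℕ} (S : Fin n → Fin M → Datum X) (θ : Θ) (i j : Fin n) : ℝ :=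
  1 / (M : ℝ) * ∑ m, D.d (D.fhat (S i m).1 θ) (D.fhat (D.T (S i m).1 (S i m).2.1 j).1 θ)

/-- Empirical counterpart of `ρ^s(f̂(·, θ))`. -/
def empρ {M : ℕ} (S : Fin n → Fin M → Datum X) (θ : Θ) (s : Fin n) : ℝ :=
  |1 / (M : ℝ) * ∑ m, fairG (D.p₁ s) (D.fhat (S s m).1 θ) (S s m).2.1|

/-- The optimal value of the empirical, parameterized dual problem. -/
def empDual {M : ℕ} (γ₁ γ₂ : ℝ) (S : Fin n → Fin M → Datum X) : EReal :=
  ⨆ (l₁ : Fin n → Fin n → ℝ) (l₂ : Fin n → Fin n → ℝ) (_ : DualNonneg l₁ l₂),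
    ⨅ θ : Θ, (lagr (D.empR S θ) (D.empδ S θ) (D.empρ S θ) γ₁ γ₂ l₁ l₂ : EReal)

/-- `f̂` is a `ξ`-parameterization of `F`, in mean under each source domain. -/
def IsParameterization (ξ : ℝ) : Prop :=
  ∀ f ∈ D.F, ∃ θ : Θ, ∀ s, ∫ q, |D.fhat q.1 θ - f q.1| ∂(D.P s) ≤ ξ

/-- Measurability conventions and the standing conventions on the objects: the domains are
probability measures with both sensitive subgroups present, `F` is a convex class of classifiers
with (relaxed) values in `[0, 1]` that contains the parameterized ones. -/
structure Wellposed [MeasurableSpace Θ] : Prop where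
  prob : ∀ s, IsProbabilityMeasure (D.P s)
  groups : ∀ s, 0 < D.p₁ s ∧ D.p₁ s < 1
  weights : (∀ s, 0 ≤ D.w s) ∧ ∑ s, D.w s = 1
  measurable_T : ∀ s, Measurable fun q : X × Sens => D.T q.1 q.2 s
  measurable_d : Measurable fun a : ℝ × ℝ => D.d a.1 a.2
  measurable_fhat : Measurable fun q : X × Θ => D.fhat q.1 q.2
  measurable_F : ∀ f ∈ D.F, Measurable f
  range_F : ∀ f ∈ D.F, ∀ x, f x ∈ Icc (0 : ℝ) 1
  convex_F : Convex ℝ D.F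
  param_subset : D.paramClass ⊆ D.F

/-- The loss is `[0, B]`-bounded, convex and `Lℓ`-Lipschitz in the prediction. -/
structure LossAssumption (B Lℓ : ℝ) : Prop where
  bounded : ∀ a ∈ Icc (0 : ℝ) 1, ∀ y, D.loss a y ∈ Icc 0 B
  convex : ∀ y, ConvexOn ℝ (Icc (0 : ℝ) 1) fun a => D.loss a y
  lipschitz : ∀ a ∈ Icc (0 : ℝ) 1, ∀ b ∈ Icc (0 : ℝ) 1, ∀ y,
    |D.loss a y - D.loss b y| ≤ Lℓ * |a - b|

/-- The distance is `[0, B]`-bounded, convex, vanishes exactly on equal predictions, and is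
Lipschitz with constant `Ld`. Both Lipschitz fields follow from the pointwise inequality
`|d[f₁ x, f₁ x'] - d[f₂ x, f₂ x']| ≤ Ld |f₁ x - f₂ x|` for `x' = T(x, z, s)`, which is not
required. -/
structure DistAssumption (B Ld : ℝ) : Prop where
  bounded : ∀ a ∈ Icc (0 : ℝ) 1, ∀ b ∈ Icc (0 : ℝ) 1, D.d a b ∈ Icc 0 B
  convex : ConvexOn ℝ (Icc (0 : ℝ) 1 ×ˢ Icc (0 : ℝ) 1) fun a : ℝ × ℝ => D.d a.1 a.2
  eq_zero_iff : ∀ a ∈ Icc (0 : ℝ) 1, ∀ b ∈ Icc (0 : ℝ) 1, D.d a b = 0 ↔ a = b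
  lipschitz : ∀ f₁ ∈ D.F, ∀ f₂ ∈ D.F, ∀ x z s,
    |D.d (f₁ x) (f₁ (D.T x z s).1) - D.d (f₂ x) (f₂ (D.T x z s).1)| ≤
      Ld * (|f₁ x - f₂ x| + |f₁ (D.T x z s).1 - f₂ (D.T x z s).1|)
  lipschitz_mean : ∀ f₁ ∈ D.F, ∀ f₂ ∈ D.F, ∀ i j, i ≠ j →
    |D.δ f₁ i j - D.δ f₂ i j| ≤ Ld * ∫ q, |f₁ q.1 - f₂ q.1| ∂(D.P i)

/-- The fairness function of each source domain is bounded by `B` and `Lg`-Lipschitz in the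
prediction (it is linear in the prediction, hence convex). -/
structure FairAssumption (B Lg : ℝ) : Prop where
  bounded : ∀ s, ∀ a ∈ Icc (0 : ℝ) 1, ∀ z, |fairG (D.p₁ s) a z| ≤ B
  lipschitz : ∀ s, ∀ a ∈ Icc (0 : ℝ) 1, ∀ b ∈ Icc (0 : ℝ) 1, ∀ z,
    |fairG (D.p₁ s) a z - fairG (D.p₁ s) b z| ≤ Lg * |a - b|

/-- Strict feasibility of some parameter, with slack `η`; since there are finitely many pairs of
domains, this for some `η > 0` is the same as all the inequalities with `η = 0` being strict. -/
def StrictlyFeasible (ξ Lℓ Ld Lg γ₁ γ₂ η : ℝ) : Prop :=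
  ∃ θ : Θ, ∀ i j, i ≠ j →
    D.δ (fun x => D.fhat x θ) i j ≤ γ₁ - ξ * max Lℓ Ld - η ∧
    D.ρ (fun x => D.fhat x θ) i + D.ρ (fun x => D.fhat x θ) j ≤ γ₂ - ξ * max Lℓ Lg - η

end FairDG

end

open scoped ENNReal Topology

/-! The gap estimate is deterministic once the empirical risk and constraints are within `t` of the
true ones at every `θ` (`UniformlyClose`). The only random ingredient is a uniform law of large
numbers, with `t` of order `√(log M / M)`.

Upper bound (`empDual_le`). At any multiplier whose empirical dual value exceeds the claimed bound,
the strictly feasible parameter limits the `ℓ¹` norm to `2 n b / η`, so sampling errors cost a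
multiple of `t`. Every `f ∈ F` is approximated by a parameter. The constraint errors, at most `ξ k`
for `δ` and `2 ξ k` for `ρ i + ρ j`, are exactly what tightening the levels absorbs; the risk loses
`ξ k`. The value is thus controlled by the perturbed dual function at that multiplier, hence by its
maximum, attained at the optimal dual variable `λ`. Relaxing the levels again costs `ξ k ‖λ‖₁`, and
weak duality compares with `P⋆ = P⋆(0, 0)`.

Lower bound (`le_empDual`). By convexity and strict feasibility the problem at levels `γ` has
multipliers with Lagrangian at least `P⋆(γ)` on all of `F`, in particular on the parameterized
class. Their norm is bounded in the same way, so the empirical Lagrangian loses a multiple of `t`.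
Lipschitz continuity of the perturbation function compares `P⋆(γ)` with `P⋆(0, 0)`.

Uniform closeness comes from symmetrization with a ghost sample, Hoeffding's inequality for random
swaps, and covers of polynomial size from the Sauer-Shelah lemma for subgraphs
(`measure_exists_deviation_le`, `pairCover_of_vcDimLE`). A supremum over an uncountable `Θ` gives
events that are projections of Borel sets; these are universally measurable, which is what averaging
over swaps needs. -/

/-! ### Universal measurability of analytic sets -/

theorem isCompact_setOf_forall_le (k : ℕ → ℕ) : IsCompact {x : ℕ → ℕ | ∀ i, x i ≤ k i} := by
  have h := isCompact_univ_pi (s := fun i => Set.Iic (k i)) fun i => (Set.finite_Iic (k i)).isCompact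
  convert! h using 1
  ext x
  simp [Pi.le_def]

/-- An open set that contains all sequences bounded by `k` contains all sequences whose first
entries are bounded by those of `k`. -/
theorem exists_forall_lt_le_subset {k : ℕ → ℕ} {O : Set (ℕ → ℕ)} (hO : IsOpen O)
    (hk : {x : ℕ → ℕ | ∀ i, x i ≤ k i} ⊆ O) :
    ∃ m : ℕ, {x : ℕ → ℕ | ∀ i < m, x i ≤ k i} ⊆ O := by
  by_contra! hcon
  have hx : ∀ m, ∃ x : ℕ → ℕ, (∀ i < m, x i ≤ k i) ∧ x ∉ O := fun m => by
    obtain ⟨x, h1, h2⟩ := Set.not_subset.1 (hcon m)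
    exact ⟨x, h1, h2⟩
  choose x hx hxO using hx
  -- Truncation by `k` moves the points into a compact set. Each coordinate is eventually unaffected
  -- by it, so the untruncated subsequence has the same limit.
  obtain ⟨y, hy, φ, hφ, hlim⟩ := (isCompact_setOf_forall_le k).tendsto_subseq (x := fun m i => min (x m i) (k i))
    (fun m i => min_le_right _ _)
  have hlim' : Filter.Tendsto (x ∘ φ) Filter.atTop (𝓝 y) := by
    rw [tendsto_pi_nhds] at hlim ⊢
    intro i
    refine (hlim i).congr' ?_
    filter_upwards [Filter.eventually_gt_atTop i] with m hm
    simpa using hx (φ m) i (hm.trans_le (hφ.id_le m))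
  obtain ⟨m, hm⟩ := (hlim'.eventually (hO.mem_nhds (hk hy))).exists
  exact hxO _ hm

/-- A continuous image of the Baire space has compact subsets of almost full measure. -/
theorem exists_isCompact_subset_range {α : Type*} [TopologicalSpace α] [PolishSpace α]
    [MeasurableSpace α] [BorelSpace α] (μ : Measure α) [IsFiniteMeasure μ] {f : (ℕ → ℕ) → α}
    (hf : Continuous f) {a : ℝ≥0∞} (ha : a < μ (range f)) :
    ∃ K ⊆ range f, IsCompact K ∧ a ≤ μ K := by
  let := TopologicalSpace.upgradeIsCompletelyMetrizable α
  -- Bounding one more coordinate keeps the image above `a`: the images increase to `f '' A`, and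
  -- continuity from below needs no measurability along a monotone sequence.
  have step : ∀ (A : Set (ℕ → ℕ)) (m : ℕ), ∃ j : ℕ,
      a < μ (f '' A) → a < μ (f '' (A ∩ {x | x m ≤ j})) := by
    intro A m
    by_cases hA : a < μ (f '' A)
    · have hU : f '' A = ⋃ j : ℕ, f '' (A ∩ {x | x m ≤ j}) := by
        rw [← image_iUnion, ← inter_iUnion]
        congr 1
        ext x
        simp only [mem_inter_iff, mem_iUnion, mem_ofPred_eq, iff_self_and]
        exact fun _ => ⟨x m, le_rfl⟩
      have hmono : Monotone fun j : ℕ => f '' (A ∩ {x | x m ≤ j}) := fun i j hij =>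
        image_mono (inter_subset_inter_right _ fun x (hx : x m ≤ i) => hx.trans hij)
      rw [hU, hmono.measure_iUnion, lt_iSup_iff] at hA
      obtain ⟨j, hj⟩ := hA
      exact ⟨j, fun _ => hj⟩
    · exact ⟨0, fun h => absurd h hA⟩
  choose j hj using step
  let A : ℕ → Set (ℕ → ℕ) := fun m => Nat.rec univ (fun m A => A ∩ {x | x m ≤ j A m}) m
  let k : ℕ → ℕ := fun m => j (A m) m
  have hA : ∀ m, A m = {x | ∀ i < m, x i ≤ k i} := by
    intro m
    induction m with
    | zero => simp [A]
    | succ m ih =>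
      have : A (m + 1) = A m ∩ {x | x m ≤ k m} := rfl
      rw [this, ih]
      ext x
      simp only [mem_inter_iff, mem_ofPred_eq, Nat.lt_succ_iff_lt_or_eq]
      constructor
      · rintro ⟨h1, h2⟩ i (hi | rfl)
        exacts [h1 i hi, h2]
      · exact fun h => ⟨fun i hi => h i (Or.inl hi), h m (Or.inr rfl)⟩
  have hμA : ∀ m, a < μ (f '' A m) := by
    intro m
    induction m with
    | zero => simpa [A] using ha
    | succ m ih => exact hj (A m) m ih
  refine ⟨f '' {x | ∀ i, x i ≤ k i}, image_subset_range _ _, (isCompact_setOf_forall_le k).image hf, ?_⟩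
  -- Outer regularity: an open set around the compact image already contains the image of some `A
  -- m`, whose measure exceeds `a`.
  rw [Set.measure_eq_iInf_isOpen]
  refine le_iInf₂ fun U hU => le_iInf fun hUo => ?_
  obtain ⟨m, hm⟩ := exists_forall_lt_le_subset (hUo.preimage hf) (image_subset_iff.1 hU)
  rw [← hA] at hm
  exact (hμA m).le.trans (measure_mono (image_subset_iff.2 hm))

/-- Analytic sets are universally measurable. -/
theorem analyticSet_nullMeasurableSet {α : Type*} [TopologicalSpace α] [PolishSpace α]
    [MeasurableSpace α] [BorelSpace α] (μ : Measure α) [IsFiniteMeasure μ] {s : Set α}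
    (hs : AnalyticSet s) : NullMeasurableSet s μ := by
  rw [AnalyticSet] at hs
  rcases hs with rfl | ⟨f, hf, rfl⟩
  · exact MeasurableSet.empty.nullMeasurableSet
  rcases eq_or_ne (μ (range f)) 0 with h0 | h0
  · exact NullMeasurableSet.of_null h0
  obtain ⟨u, -, hu, hlim⟩ := exists_seq_strictMono_tendsto' (pos_iff_ne_zero.2 h0)
  choose K hK hKc hμK using fun m => exists_isCompact_subset_range μ hf (hu m).2
  have hm : MeasurableSet (⋃ m, K m) := MeasurableSet.iUnion fun m => (hKc m).measurableSet
  refine hm.nullMeasurableSet.congr (ae_eq_of_subset_of_measure_ge (iUnion_subset hK) ?_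
    hm.nullMeasurableSet (measure_ne_top _ _))
  exact le_of_tendsto' hlim fun m => (hμK m).trans (measure_mono (subset_iUnion K m))

/-- Projections of measurable sets along standard Borel spaces are universally measurable. -/
theorem nullMeasurableSet_exists {W Θ : Type*} [MeasurableSpace W] [StandardBorelSpace W]
    [MeasurableSpace Θ] [StandardBorelSpace Θ] (μ : Measure W) [IsFiniteMeasure μ]
    {E : Set (W × Θ)} (hE : MeasurableSet E) : NullMeasurableSet {w | ∃ θ, (w, θ) ∈ E} μ := by
  let := upgradeStandardBorel W
  have : {w | ∃ θ, (w, θ) ∈ E} = Prod.fst '' E := by ext; simp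
  rw [this]
  exact analyticSet_nullMeasurableSet μ (hE.analyticSet_image measurable_fst)

/-! ### Symmetrization and the uniform law of large numbers -/

/-- The sign attached to a swap. -/
def swapSign (b : Bool) : ℝ := if b then -1 else 1

/-- The signs are independent, so the sum factors into terms `2 cosh (s a i)`, each at most `2 exp
(s² c² / 2)`. -/
theorem sum_exp_swapSign_le {M : ℕ} {c : ℝ} (a : Fin M → ℝ) (ha : ∀ i, |a i| ≤ c) (s : ℝ) :
    ∑ σ : Fin M → Bool, Real.exp (s * ∑ i, swapSign (σ i) * a i) ≤
      2 ^ M * Real.exp (M * (s ^ 2 * c ^ 2 / 2)) := by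
  have h1 : ∑ σ : Fin M → Bool, Real.exp (s * ∑ i, swapSign (σ i) * a i) =
      ∏ i, ∑ b : Bool, Real.exp (s * (swapSign b * a i)) := by
    rw [Finset.prod_univ_sum, Fintype.piFinset_univ]
    refine Finset.sum_congr rfl fun σ _ => ?_
    rw [Finset.mul_sum, Real.exp_sum]
  rw [h1]
  have h2 : ∀ i ∈ Finset.univ, ∑ b : Bool, Real.exp (s * (swapSign b * a i)) ≤
      2 * Real.exp (s ^ 2 * c ^ 2 / 2) := by
    intro i _
    have h3 : ∑ b : Bool, Real.exp (s * (swapSign b * a i)) = 2 * Real.cosh (s * a i) := by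
      rw [Fintype.sum_bool, Real.cosh_eq]
      simp only [swapSign, if_true, Bool.false_eq_true, if_false]
      ring_nf
    rw [h3]
    have h4 : (s * a i) ^ 2 ≤ s ^ 2 * c ^ 2 := by
      rw [mul_pow]
      exact mul_le_mul_of_nonneg_left (sq_le_sq.2 ((ha i).trans (le_abs_self c))) (sq_nonneg s)
    have h5 := (Real.cosh_le_exp_half_sq (s * a i)).trans
      (Real.exp_le_exp.2 (div_le_div_of_nonneg_right h4 zero_le_two))
    linarith
  refine (Finset.prod_le_prod (fun i _ => Finset.sum_nonneg fun b _ => (Real.exp_pos _).le) h2).trans ?_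
  rw [Finset.prod_const, Finset.card_univ, Fintype.card_fin, mul_pow, ← Real.exp_nat_mul]

/-- Hoeffding's inequality for signed sums, as a count of signs, one-sided. -/
theorem card_swapSign_le {M : ℕ} (hM : 0 < M) {c u : ℝ} (hc : 0 < c) (a : Fin M → ℝ)
    (ha : ∀ i, |a i| ≤ c) (hu : 0 ≤ u) :
    ((Finset.univ.filter fun σ : Fin M → Bool => u < ∑ i, swapSign (σ i) * a i).card : ℝ) ≤
      2 ^ M * Real.exp (-(u ^ 2 / (2 * M * c ^ 2))) := by
  have hM' : (0 : ℝ) < M := by exact_mod_cast hM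
  -- The minimizer of the Chernoff exponent `M s² c² / 2 - s u`.
  set s : ℝ := u / (M * c ^ 2) with hs
  have hs0 : 0 ≤ s := by positivity
  have h1 := sum_exp_swapSign_le a ha s
  have h2 : ((Finset.univ.filter fun σ : Fin M → Bool => u < ∑ i, swapSign (σ i) * a i).card : ℝ)
      * Real.exp (s * u) ≤ ∑ σ : Fin M → Bool, Real.exp (s * ∑ i, swapSign (σ i) * a i) := by
    rw [← nsmul_eq_mul, ← Finset.sum_const]
    refine (Finset.sum_le_sum fun σ hσ => ?_).trans (Finset.sum_le_sum_of_subset_of_nonneg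
      (Finset.filter_subset _ _) fun _ _ _ => (Real.exp_pos _).le)
    exact Real.exp_le_exp.2 (mul_le_mul_of_nonneg_left (Finset.mem_filter.1 hσ).2.le hs0)
  have h3 := h2.trans h1
  rw [← le_div_iff₀ (Real.exp_pos _)] at h3
  refine h3.trans (le_of_eq ?_)
  rw [mul_div_assoc, ← Real.exp_sub]
  congr 2
  rw [hs]
  field_simp
  ring

theorem card_abs_swapSign_le {M : ℕ} (hM : 0 < M) {c u : ℝ} (hc : 0 < c) (a : Fin M → ℝ)
    (ha : ∀ i, |a i| ≤ c) (hu : 0 ≤ u) :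
    ((Finset.univ.filter fun σ : Fin M → Bool => u < |∑ i, swapSign (σ i) * a i|).card : ℝ) ≤
      2 ^ M * (2 * Real.exp (-(u ^ 2 / (2 * M * c ^ 2)))) := by
  classical
  have h1 := card_swapSign_le hM hc a ha hu
  have h2 := card_swapSign_le hM hc (fun i => -a i) (fun i => by rw [abs_neg]; exact ha i) hu
  have h3 : (Finset.univ.filter fun σ : Fin M → Bool => u < |∑ i, swapSign (σ i) * a i|) ⊆
      (Finset.univ.filter fun σ : Fin M → Bool => u < ∑ i, swapSign (σ i) * a i) ∪
      (Finset.univ.filter fun σ : Fin M → Bool => u < ∑ i, swapSign (σ i) * -a i) := by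
    intro σ hσ
    simp only [Finset.mem_filter, Finset.mem_univ, true_and, Finset.mem_union, mul_neg,
      Finset.sum_neg_distrib] at hσ ⊢
    exact lt_abs.1 hσ
  have h4 : ((Finset.univ.filter fun σ : Fin M → Bool =>
      u < |∑ i, swapSign (σ i) * a i|).card : ℝ) ≤ _ :=
    Nat.cast_le.2 ((Finset.card_le_card h3).trans (Finset.card_union_le _ _))
  push_cast at h4
  linarith

/-- Swap the two members of the pairs selected by `σ`. -/
def swapPairs {Z : Type*} {M : ℕ} (σ : Fin M → Bool) (z : Fin M → Z × Z) : Fin M → Z × Z :=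
  fun i => if σ i then (z i).swap else z i

theorem measurePreserving_swapPairs {Z : Type*} [MeasurableSpace Z] {M : ℕ} (μ : Measure Z)
    [IsProbabilityMeasure μ] (σ : Fin M → Bool) :
    MeasurePreserving (swapPairs σ) (Measure.pi fun _ : Fin M => μ.prod μ)
      (Measure.pi fun _ : Fin M => μ.prod μ) := by
  refine measurePreserving_pi (f := fun i (q : Z × Z) => if σ i then q.swap else q)
    (fun _ : Fin M => μ.prod μ) (fun _ : Fin M => μ.prod μ) fun i => ?_
  cases σ i
  · exact MeasurePreserving.id (μ.prod μ)
  · simpa using Measure.measurePreserving_swap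

-- Every swap preserves the law of the pairs, so the measure of `A` is the mean, over pairs and
-- swaps, of the indicator of `A`. A bound on the number of swaps for each fixed `z` therefore
-- suffices, and the randomness left is that of signs alone.
open scoped Classical in
theorem measure_pi_prod_le_of_card_swapPairs_le {Z : Type*} [MeasurableSpace Z] {M : ℕ}
    (μ : Measure Z) [IsProbabilityMeasure μ] {A : Set (Fin M → Z × Z)}
    (hA : NullMeasurableSet A (Measure.pi fun _ : Fin M => μ.prod μ)) {c : ℝ}
    (h : ∀ z, ((Finset.univ.filter fun σ : Fin M → Bool => swapPairs σ z ∈ A).card : ℝ) ≤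
      2 ^ M * c) :
    (Measure.pi fun _ : Fin M => μ.prod μ) A ≤ ENNReal.ofReal c := by
  set ν := Measure.pi fun _ : Fin M => μ.prod μ with hν
  have h1 : ∀ σ : Fin M → Bool, ∫⁻ z, (swapPairs σ ⁻¹' A).indicator 1 z ∂ν = ν A := fun σ => by
    have hm := measurePreserving_swapPairs (M := M) μ σ
    rw [lintegral_indicator_one₀ (hA.preimage hm.quasiMeasurePreserving), hm.measure_preimage hA]
  have h2 : (2 : ℝ≥0∞) ^ M * ν A ≤ 2 ^ M * ENNReal.ofReal c := by
    calc (2 : ℝ≥0∞) ^ M * ν A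
        = ∑ σ : Fin M → Bool, ∫⁻ z, (swapPairs σ ⁻¹' A).indicator 1 z ∂ν := by
          simp [h1]
      _ = ∫⁻ z, ∑ σ : Fin M → Bool, (swapPairs σ ⁻¹' A).indicator 1 z ∂ν := by
          rw [lintegral_finsetSum' _ fun σ _ => ?_]
          exact aemeasurable_one.indicator₀ (hA.preimage
            (measurePreserving_swapPairs μ σ).quasiMeasurePreserving)
      _ ≤ ∫⁻ _, 2 ^ M * ENNReal.ofReal c ∂ν := by
          refine lintegral_mono fun z => ?_
          have h3 : ∑ σ : Fin M → Bool, (swapPairs σ ⁻¹' A).indicator (1 : (Fin M → Z × Z) → ℝ≥0∞) z =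
              ((Finset.univ.filter fun σ : Fin M → Bool => swapPairs σ z ∈ A).card : ℝ≥0∞) := by
            rw [Finset.card_filter]
            push_cast
            rfl
          rw [h3]
          have h4 := ENNReal.ofReal_le_ofReal (h z)
          rwa [ENNReal.ofReal_natCast, ENNReal.ofReal_mul (by positivity),
            ENNReal.ofReal_pow zero_le_two, ENNReal.ofReal_ofNat] at h4
      _ = 2 ^ M * ENNReal.ofReal c := by simp
  exact (ENNReal.mul_le_mul_iff_right (by positivity) (by simp)).1 h2

/-- The values of the class `H` at any `M` pairs of points are covered up to `ε` by `G`
parameters. -/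
def PairCover {Z Θ : Type*} (H : Z → Θ → ℝ) (M G : ℕ) (ε : ℝ) : Prop :=
  ∀ z : Fin M → Z × Z, ∃ s : Finset Θ, s.card ≤ G ∧ ∀ θ, ∃ θ' ∈ s, ∀ i,
    |H (z i).1 θ - H (z i).1 θ'| ≤ ε ∧ |H (z i).2 θ - H (z i).2 θ'| ≤ ε

theorem sum_sub_swapPairs {Z Θ : Type*} {M : ℕ} (H : Z → Θ → ℝ) (σ : Fin M → Bool)
    (z : Fin M → Z × Z) (θ : Θ) :
    ∑ i, (H (swapPairs σ z i).1 θ - H (swapPairs σ z i).2 θ) =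
      ∑ i, swapSign (σ i) * (H (z i).1 θ - H (z i).2 θ) := by
  refine Finset.sum_congr rfl fun i _ => ?_
  rcases h : σ i <;> simp [swapPairs, swapSign, h]

/-- With the pairs fixed, the cover reduces the supremum over `θ` to at most `G` signed sums, each
treated by Hoeffding's inequality. The rounding error `2 M ε ≤ M t / 4` lowers the threshold from `M
t / 2` to `M t / 4`; differences are bounded by `2 b`, whence the constant 128. -/
theorem measure_exists_pair_deviation_le {Z Θ : Type*} [MeasurableSpace Z] [StandardBorelSpace Z]
    [MeasurableSpace Θ] [StandardBorelSpace Θ] (μ : Measure Z) [IsProbabilityMeasure μ]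
    {H : Z → Θ → ℝ} (hH : Measurable fun q : Z × Θ => H q.1 q.2) {b : ℝ} (hb : 0 < b)
    (hHb : ∀ q θ, |H q θ| ≤ b) {M G : ℕ} (hM : 0 < M) {ε t : ℝ} (ht : 0 ≤ t) (hεt : 8 * ε ≤ t)
    (hcov : PairCover H M G ε) :
    NullMeasurableSet {z : Fin M → Z × Z | ∃ θ, M * t / 2 < |∑ i, (H (z i).1 θ - H (z i).2 θ)|}
      (Measure.pi fun _ : Fin M => μ.prod μ) ∧
    (Measure.pi fun _ : Fin M => μ.prod μ)
      {z : Fin M → Z × Z | ∃ θ, M * t / 2 < |∑ i, (H (z i).1 θ - H (z i).2 θ)|} ≤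
      ENNReal.ofReal (G * (2 * Real.exp (-(M * t ^ 2 / (128 * b ^ 2))))) := by
  classical
  have hM' : (0 : ℝ) < M := by exact_mod_cast hM
  have hA : NullMeasurableSet
      {z : Fin M → Z × Z | ∃ θ, M * t / 2 < |∑ i, (H (z i).1 θ - H (z i).2 θ)|}
      (Measure.pi fun _ : Fin M => μ.prod μ) := by
    refine nullMeasurableSet_exists (Θ := Θ) _
      (E := {w : (Fin M → Z × Z) × Θ | M * t / 2 < |∑ i, (H (w.1 i).1 w.2 - H (w.1 i).2 w.2)|}) ?_
    have hg : Measurable fun w : (Fin M → Z × Z) × Θ =>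
        ∑ i, (H (w.1 i).1 w.2 - H (w.1 i).2 w.2) := by
      refine Finset.measurable_sum _ fun i _ => ?_
      exact (hH.comp (by fun_prop : Measurable fun w : (Fin M → Z × Z) × Θ => ((w.1 i).1, w.2))).sub
        (hH.comp (by fun_prop : Measurable fun w : (Fin M → Z × Z) × Θ => ((w.1 i).2, w.2)))
    exact measurableSet_lt measurable_const (continuous_abs.measurable.comp hg)
  refine ⟨hA, measure_pi_prod_le_of_card_swapPairs_le μ hA fun z => ?_⟩
  obtain ⟨s, hs, hcov⟩ := hcov z
  have hsub : (Finset.univ.filter fun σ : Fin M → Bool => swapPairs σ z ∈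
      {z : Fin M → Z × Z | ∃ θ, M * t / 2 < |∑ i, (H (z i).1 θ - H (z i).2 θ)|}) ⊆
      s.biUnion fun θ => Finset.univ.filter fun σ : Fin M → Bool =>
        M * t / 4 < |∑ i, swapSign (σ i) * (H (z i).1 θ - H (z i).2 θ)| := by
    intro σ hσ
    simp only [Finset.mem_filter, Finset.mem_univ, true_and, mem_ofPred_eq, sum_sub_swapPairs,
      Finset.mem_biUnion] at hσ ⊢
    obtain ⟨θ, hθ⟩ := hσ
    obtain ⟨θ', hθ', hc⟩ := hcov θ
    refine ⟨θ', hθ', ?_⟩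
    have h1 : |∑ i, swapSign (σ i) * (H (z i).1 θ - H (z i).2 θ) -
        ∑ i, swapSign (σ i) * (H (z i).1 θ' - H (z i).2 θ')| ≤ M * (2 * ε) := by
      rw [← Finset.sum_sub_distrib]
      refine (Finset.abs_sum_le_sum_abs _ _).trans ?_
      have : ∀ i ∈ (Finset.univ : Finset (Fin M)), |swapSign (σ i) * (H (z i).1 θ - H (z i).2 θ) -
          swapSign (σ i) * (H (z i).1 θ' - H (z i).2 θ')| ≤ 2 * ε := by
        intro i _
        have hsgn : |swapSign (σ i)| = 1 := by
          unfold swapSign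
          split_ifs <;> simp
        rw [← mul_sub, abs_mul, hsgn, one_mul]
        have h3 := abs_le.1 (hc i).1
        have h4 := abs_le.1 (hc i).2
        exact abs_le.2 ⟨by linarith [h3.1, h4.2], by linarith [h3.2, h4.1]⟩
      refine (Finset.sum_le_sum this).trans (le_of_eq ?_)
      simp
    have h2 := abs_sub_abs_le_abs_sub (∑ i, swapSign (σ i) * (H (z i).1 θ - H (z i).2 θ))
      (∑ i, swapSign (σ i) * (H (z i).1 θ' - H (z i).2 θ'))
    have h3 : M * (8 * ε) ≤ M * t := mul_le_mul_of_nonneg_left hεt hM'.le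
    linarith
  have hone : ∀ θ ∈ s, ((Finset.univ.filter fun σ : Fin M → Bool =>
        M * t / 4 < |∑ i, swapSign (σ i) * (H (z i).1 θ - H (z i).2 θ)|).card : ℝ) ≤
      2 ^ M * (2 * Real.exp (-(M * t ^ 2 / (128 * b ^ 2)))) := by
    intro θ _
    refine (card_abs_swapSign_le hM (c := 2 * b) (by positivity) _ (fun i => ?_)
      (by positivity)).trans (le_of_eq ?_)
    · have h3 := abs_le.1 (hHb (z i).1 θ)
      have h4 := abs_le.1 (hHb (z i).2 θ)
      exact abs_le.2 ⟨by linarith [h3.1, h4.2], by linarith [h3.2, h4.1]⟩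
    · congr 4
      field_simp
      ring
  calc ((Finset.univ.filter fun σ : Fin M → Bool => swapPairs σ z ∈
      {z : Fin M → Z × Z | ∃ θ, M * t / 2 < |∑ i, (H (z i).1 θ - H (z i).2 θ)|}).card : ℝ)
      ≤ ∑ θ ∈ s, ((Finset.univ.filter fun σ : Fin M → Bool =>
        M * t / 4 < |∑ i, swapSign (σ i) * (H (z i).1 θ - H (z i).2 θ)|).card : ℝ) := by
        exact_mod_cast (Finset.card_le_card hsub).trans Finset.card_biUnion_le
    _ ≤ ∑ θ ∈ s, 2 ^ M * (2 * Real.exp (-(M * t ^ 2 / (128 * b ^ 2)))) := Finset.sum_le_sum hone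
    _ = s.card * (2 ^ M * (2 * Real.exp (-(M * t ^ 2 / (128 * b ^ 2))))) := by simp
    _ ≤ G * (2 ^ M * (2 * Real.exp (-(M * t ^ 2 / (128 * b ^ 2))))) := by
        refine mul_le_mul_of_nonneg_right (by exact_mod_cast hs) (by positivity)
    _ = 2 ^ M * (G * (2 * Real.exp (-(M * t ^ 2 / (128 * b ^ 2))))) := by ring

/-- Chebyshev's inequality for sums of bounded i.i.d. variables. -/
theorem measure_pi_abs_sum_sub_ge_le {Z : Type*} [MeasurableSpace Z] (μ : Measure Z)
    [IsProbabilityMeasure μ] {h : Z → ℝ} (hh : Measurable h) {b : ℝ} (hhb : ∀ q, |h q| ≤ b)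
    {M : ℕ} (hM : 0 < M) {t : ℝ} (ht : 0 < t) (hbt : 8 * b ^ 2 ≤ M * t ^ 2) :
    (Measure.pi fun _ : Fin M => μ) {x | M * t / 2 ≤ |∑ i, h (x i) - M * ∫ q, h q ∂μ|} ≤
      ENNReal.ofReal (1 / 2) := by
  have hM' : (0 : ℝ) < M := by exact_mod_cast hM
  have hL : MemLp h 2 μ := MemLp.of_bound hh.aestronglyMeasurable b (ae_of_all _ hhb)
  have hLi : ∀ i : Fin M, MemLp (fun x : Fin M → Z => h (x i)) 2 (Measure.pi fun _ : Fin M => μ) :=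
    fun i => hL.comp_measurePreserving (measurePreserving_eval (fun _ : Fin M => μ) i)
  have hvar := ProbabilityTheory.variance_sum_pi (μ := fun _ : Fin M => μ) (X := fun _ => h)
    fun _ => hL
  have hmean : ∫ x, (∑ i, fun x : Fin M → Z => h (x i)) x ∂(Measure.pi fun _ : Fin M => μ) =
      M * ∫ q, h q ∂μ := by
    simp only [Finset.sum_apply]
    rw [integral_finsetSum _ fun i _ => (hLi i).integrable one_le_two]
    have : ∀ i : Fin M, ∫ x, h (x i) ∂(Measure.pi fun _ : Fin M => μ) = ∫ q, h q ∂μ := fun i => by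
      have h1 := measurePreserving_eval (fun _ : Fin M => μ) i
      have h2 := integral_map (f := h) h1.aemeasurable hh.aestronglyMeasurable
      rw [h1.map_eq] at h2
      exact h2.symm
    simp [this]
  have hch := ProbabilityTheory.meas_ge_le_variance_div_sq
    (memLp_finsetSum' Finset.univ fun i _ => hLi i) (c := M * t / 2) (by positivity)
  rw [hmean, hvar] at hch
  simp only [Finset.sum_apply] at hch
  refine hch.trans (ENNReal.ofReal_le_ofReal ?_)
  have hv : ProbabilityTheory.variance h μ ≤ b ^ 2 := by
    have := ProbabilityTheory.variance_le_sq_of_bounded (μ := μ) (a := -b) (b := b)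
      (ae_of_all _ fun q => abs_le.1 (hhb q)) hh.aemeasurable
    refine this.trans (le_of_eq ?_)
    ring
  -- Chebyshev's bound is at most `M b² / (M t / 2)² = 4 b² / (M t²)`, which `hbt` makes at most `1
  -- / 2`.
  rw [div_le_div_iff₀ (by positivity) two_pos]
  simp only [Finset.sum_const, Finset.card_univ, Fintype.card_fin, nsmul_eq_mul]
  nlinarith [mul_le_mul_of_nonneg_left hv hM'.le, mul_le_mul_of_nonneg_left hbt hM'.le]

/-- Uniform law of large numbers for a class with finite covers at finitely many points. -/
theorem measure_exists_deviation_le {Z Θ : Type*} [MeasurableSpace Z] [StandardBorelSpace Z]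
    [MeasurableSpace Θ] [StandardBorelSpace Θ] (μ : Measure Z) [IsProbabilityMeasure μ]
    {H : Z → Θ → ℝ} (hH : Measurable fun q : Z × Θ => H q.1 q.2) {b : ℝ} (hb : 0 < b)
    (hHb : ∀ q θ, |H q θ| ≤ b) {M G : ℕ} (hM : 0 < M) {ε t : ℝ} (ht : 0 < t) (hεt : 8 * ε ≤ t)
    (hbt : 8 * b ^ 2 ≤ M * t ^ 2) (hcov : PairCover H M G ε) :
    (Measure.pi fun _ : Fin M => μ)
      {x : Fin M → Z | ∃ θ, t < |1 / (M : ℝ) * ∑ i, H (x i) θ - ∫ q, H q θ ∂μ|} ≤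
      ENNReal.ofReal (4 * (G * Real.exp (-(M * t ^ 2 / (128 * b ^ 2))))) := by
  have hM' : (0 : ℝ) < M := by exact_mod_cast hM
  obtain ⟨-, hpair⟩ := measure_exists_pair_deviation_le μ hH hb hHb hM ht.le hεt hcov
  set A := {z : Fin M → Z × Z | ∃ θ, M * t / 2 < |∑ i, (H (z i).1 θ - H (z i).2 θ)|} with hA
  set ν := Measure.pi fun _ : Fin M => μ with hν
  set ρ := Measure.pi fun _ : Fin M => μ.prod μ with hρ
  let e := MeasurableEquiv.arrowProdEquivProdArrow Z Z (Fin M)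
  have he : MeasurePreserving e ρ (ν.prod ν) :=
    measurePreserving_arrowProdEquivProdArrow Z Z (Fin M) (fun _ => μ) (fun _ => μ)
  -- A measurable hull of the pair event, of the same measure, to which Tonelli and Markov apply.
  set A₂ : Set ((Fin M → Z) × (Fin M → Z)) := e.symm ⁻¹' toMeasurable ρ A with hA₂
  have hA₂m : MeasurableSet A₂ := e.symm.measurable (measurableSet_toMeasurable _ _)
  have hA₂ν : (ν.prod ν) A₂ = ρ A := by
    rw [hA₂, (he.symm e).measure_preimage (measurableSet_toMeasurable _ _).nullMeasurableSet,
      measure_toMeasurable]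
  have hsub : {x : Fin M → Z | ∃ θ, t < |1 / (M : ℝ) * ∑ i, H (x i) θ - ∫ q, H q θ ∂μ|} ⊆
      {x | (2⁻¹ : ℝ≥0∞) ≤ ν (Prod.mk x ⁻¹' A₂)} := by
    rintro x ⟨θ, hθ⟩
    have hHθ : Measurable fun q => H q θ := hH.comp (measurable_id.prodMk measurable_const)
    have hdev : M * t < |∑ i, H (x i) θ - M * ∫ q, H q θ ∂μ| := by
      have h1 : ∑ i, H (x i) θ - M * ∫ q, H q θ ∂μ =
          M * (1 / (M : ℝ) * ∑ i, H (x i) θ - ∫ q, H q θ ∂μ) := by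
        field_simp
      rw [h1, abs_mul, abs_of_pos hM']
      exact mul_lt_mul_of_pos_left hθ hM'
    have hmeas : MeasurableSet {y : Fin M → Z | M * t / 2 ≤ |∑ i, H (y i) θ - M * ∫ q, H q θ ∂μ|} := by
      refine measurableSet_le measurable_const (continuous_abs.measurable.comp (Measurable.sub ?_
        measurable_const))
      exact Finset.measurable_sum _ fun i _ => hHθ.comp (measurable_pi_apply i)
    -- At this single `θ`, a ghost sample stays within `t / 2` of the mean with probability at least
    -- `1 / 2`. The two samples then differ by more than `t / 2`, so the slice of `A₂` at `x` has
    -- measure at least `1 / 2`.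
    have hch := measure_pi_abs_sum_sub_ge_le μ hHθ (fun q => hHb q θ) hM ht hbt
    have hcompl : {y : Fin M → Z | M * t / 2 ≤ |∑ i, H (y i) θ - M * ∫ q, H q θ ∂μ|}ᶜ ⊆
        Prod.mk x ⁻¹' A₂ := by
      intro y hy
      simp only [mem_compl_iff, mem_ofPred_eq, not_le] at hy
      refine subset_toMeasurable ρ A ⟨θ, ?_⟩
      have h2 : ∑ i, (H ((e.symm (x, y)) i).1 θ - H ((e.symm (x, y)) i).2 θ) =
          ∑ i, H (x i) θ - ∑ i, H (y i) θ := by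
        rw [← Finset.sum_sub_distrib]
        rfl
      rw [h2]
      have h3 := abs_sub_abs_le_abs_sub (∑ i, H (x i) θ - M * ∫ q, H q θ ∂μ)
        (∑ i, H (y i) θ - M * ∫ q, H q θ ∂μ)
      rw [sub_sub_sub_cancel_right] at h3
      linarith
    refine le_trans ?_ (measure_mono hcompl)
    rw [prob_compl_eq_one_sub hmeas]
    refine le_trans ?_ (tsub_le_tsub_left hch 1)
    rw [← ENNReal.ofReal_one, ← ENNReal.ofReal_sub _ (by norm_num)]
    rw [show (1 : ℝ) - 1 / 2 = 2⁻¹ by norm_num, ENNReal.ofReal_inv_of_pos two_pos,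
      ENNReal.ofReal_ofNat]
  have hmarkov := mul_meas_ge_le_lintegral (μ := ν) (measurable_measure_prodMk_left (ν := ν) hA₂m)
    2⁻¹
  rw [← Measure.prod_apply hA₂m, hA₂ν] at hmarkov
  have hle : (2⁻¹ : ℝ≥0∞) * ν {x : Fin M → Z |
      ∃ θ, t < |1 / (M : ℝ) * ∑ i, H (x i) θ - ∫ q, H q θ ∂μ|} ≤ _ :=
    ((mul_le_mul_right (measure_mono hsub) _).trans hmarkov).trans hpair
  have h4 : 4 * (G * Real.exp (-(M * t ^ 2 / (128 * b ^ 2)))) =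
    2 * (G * (2 * Real.exp (-(M * t ^ 2 / (128 * b ^ 2))))) := by ring
  rw [h4, ENNReal.ofReal_mul zero_le_two, ENNReal.ofReal_ofNat]
  calc ν _ = 2 * (2⁻¹ * ν _) := by
        rw [← mul_assoc, ENNReal.mul_inv_cancel two_ne_zero ENNReal.ofNat_ne_top, one_mul]
    _ ≤ _ := mul_le_mul_right hle 2

/-! ### Covers of classes of finite VC dimension -/

/-- The **Sauer-Shelah lemma** in polynomial form. -/
theorem card_le_pow_of_forall_shatters {α : Type*} [DecidableEq α] {𝒜 : Finset (Finset α)}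
    {S : Finset α} {V : ℕ} (hS : ∀ T ∈ 𝒜, T ⊆ S) (hV : ∀ T, 𝒜.Shatters T → T.card ≤ V) :
    𝒜.card ≤ (S.card + 1) ^ V := by
  have h1 : 𝒜.shatterer ⊆ (Finset.range (V + 1)).biUnion fun i => S.powersetCard i := by
    intro T hT
    rw [Finset.mem_shatterer] at hT
    obtain ⟨U, hU, hTU⟩ := hT.exists_superset
    simp only [Finset.mem_biUnion, Finset.mem_range, Finset.mem_powersetCard]
    exact ⟨T.card, Nat.lt_succ_of_le (hV T hT), hTU.trans (hS U hU), rfl⟩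
  calc 𝒜.card ≤ 𝒜.shatterer.card := Finset.card_le_card_shatterer 𝒜
    _ ≤ ∑ i ∈ Finset.range (V + 1), (S.powersetCard i).card :=
        (Finset.card_le_card h1).trans Finset.card_biUnion_le
    -- The factor `V.choose i ≥ 1` is inserted to recognize the binomial expansion of `(S.card + 1)
    -- ^ V`.
    _ ≤ ∑ i ∈ Finset.range (V + 1), S.card ^ i * 1 ^ (V - i) * V.choose i := by
        refine Finset.sum_le_sum fun i hi => ?_
        rw [Finset.card_powersetCard, one_pow, mul_one]
        have h2 : 0 < V.choose i := Nat.choose_pos (Nat.lt_succ_iff.1 (Finset.mem_range.1 hi))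
        exact (Nat.choose_le_pow _ _).trans (Nat.le_mul_of_pos_right _ h2)
    _ = (S.card + 1) ^ V := (add_pow _ _ _).symm

/-- If `b` exceeded `a` by more than `1 / K`, the first grid point at or above `a` would lie below
`b`, and its index would be less than `K` because `b ≤ 1`. -/
theorem sub_le_of_forall_grid {a b : ℝ} (ha : 0 ≤ a) (hb : b ≤ 1) {K : ℕ} (hK : 0 < K)
    (h : ∀ j < K, (j : ℝ) / K < b → (j : ℝ) / K < a) : b - a ≤ 1 / K := by
  have hK' : (0 : ℝ) < K := by exact_mod_cast hK
  by_contra! hcon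
  have h1 : a ≤ (⌈a * K⌉₊ : ℝ) / K := by
    rw [le_div_iff₀ hK']
    exact Nat.le_ceil _
  have h2 : (⌈a * K⌉₊ : ℝ) / K < a + 1 / K := by
    rw [div_lt_iff₀ hK', add_mul, one_div_mul_cancel hK'.ne']
    exact Nat.ceil_lt_add_one (by positivity)
  have h3 : ⌈a * K⌉₊ < K := by
    have : (⌈a * K⌉₊ : ℝ) / K < 1 := by linarith
    rw [div_lt_one hK'] at this
    exact_mod_cast this
  have h4 := h _ h3 (by linarith)
  linarith

/-- A parameterized class of finite VC dimension is covered uniformly, at finitely many points, by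
polynomially many parameters. -/
theorem exists_cover_of_vcDimLE {X Θ : Type*} {f : X → Θ → ℝ} (hf : ∀ x θ, f x θ ∈ Icc (0 : ℝ) 1)
    {V : ℕ} (hV : VCDimLE (range fun θ x => f x θ) V) (P : Finset X) {K : ℕ} (hK : 0 < K) :
    ∃ s : Finset Θ, s.card ≤ (P.card * K + 1) ^ V ∧
      ∀ θ, ∃ θ' ∈ s, ∀ x ∈ P, |f x θ - f x θ'| ≤ 1 / K := by
  classical
  -- Levels `j / K` with `j < K` suffice, since values do not exceed 1. Parameters with equal
  -- subgraph patterns on this grid differ by at most `1 / K` on `P`, so one parameter per pattern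
  -- gives the cover.
  let S : Finset (X × ℝ) := P ×ˢ (Finset.range K).image fun j : ℕ => (j : ℝ) / K
  let pat : Θ → Finset (X × ℝ) := fun θ => S.filter fun q => q.2 < f q.1 θ
  let 𝒜 : Finset (Finset (X × ℝ)) := S.powerset.filter fun U => ∃ θ, pat θ = U
  have hpat : ∀ θ, pat θ ∈ 𝒜 := fun θ =>
    Finset.mem_filter.2 ⟨Finset.mem_powerset.2 (Finset.filter_subset _ _), θ, rfl⟩
  have hS : ∀ T ∈ 𝒜, T ⊆ S := fun T hT => Finset.mem_powerset.1 (Finset.mem_filter.1 hT).1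
  have hcard : 𝒜.card ≤ (S.card + 1) ^ V := by
    refine card_le_pow_of_forall_shatters hS fun T hT => hV T fun U hU => ?_
    obtain ⟨W, hW, hTW⟩ := hT.exists_superset
    obtain ⟨u, hu, rfl⟩ := hT hU
    obtain ⟨θ, rfl⟩ := (Finset.mem_filter.1 hu).2
    refine ⟨_, ⟨θ, rfl⟩, fun q hq => ?_⟩
    have hqS : q ∈ S := hS W hW (hTW hq)
    simp [pat, hq, hqS]
  have hScard : S.card ≤ P.card * K := by
    rw [Finset.card_product]
    refine Nat.mul_le_mul_left _ (Finset.card_image_le.trans ?_)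
    rw [Finset.card_range]
  have hrep : ∀ U : 𝒜, ∃ θ, pat θ = U := fun U => (Finset.mem_filter.1 U.2).2
  choose r hr using hrep
  refine ⟨𝒜.attach.image r, ?_, fun θ => ⟨r ⟨pat θ, hpat θ⟩, Finset.mem_image_of_mem _
    (Finset.mem_attach _ _), fun x hx => ?_⟩⟩
  · refine Finset.card_image_le.trans ?_
    rw [Finset.card_attach]
    exact hcard.trans (Nat.pow_le_pow_left (Nat.succ_le_succ hScard) V)
  · have heq : pat (r ⟨pat θ, hpat θ⟩) = pat θ := hr _
    generalize r ⟨pat θ, hpat θ⟩ = θ' at heq ⊢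
    have hgrid : ∀ j < K, (j : ℝ) / K < f x θ' ↔ (j : ℝ) / K < f x θ := by
      intro j hj
      have hmem : (x, (j : ℝ) / K) ∈ S :=
        Finset.mem_product.2 ⟨hx, Finset.mem_image_of_mem _ (Finset.mem_range.2 hj)⟩
      have h1 := Finset.ext_iff.1 heq (x, (j : ℝ) / K)
      simpa only [pat, Finset.mem_filter, hmem, true_and] using h1
    rw [abs_le, neg_le_sub_iff_le_add, ← sub_le_iff_le_add']
    exact ⟨sub_le_of_forall_grid (hf x θ).1 (hf x θ').2 hK fun j hj => (hgrid j hj).1,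
      sub_le_of_forall_grid (hf x θ').1 (hf x θ).2 hK fun j hj => (hgrid j hj).2⟩

/-- A class that depends in a Lipschitz way on the values of a VC class at two points is covered by
polynomially many parameters. -/
theorem pairCover_of_vcDimLE {X Z Θ : Type*} {f : X → Θ → ℝ} (hf : ∀ x θ, f x θ ∈ Icc (0 : ℝ) 1)
    {V : ℕ} (hV : VCDimLE (range fun θ x => f x θ) V) {H : Z → Θ → ℝ} {k : ℝ} (hk : 0 ≤ k)
    (u v : Z → X) (hH : ∀ q θ θ', |H q θ - H q θ'| ≤
      k * (|f (u q) θ - f (u q) θ'| + |f (v q) θ - f (v q) θ'|)) {M : ℕ} (hM : 0 < M) :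
    PairCover H M ((4 * M * M + 1) ^ V) (2 * k / M) := by
  classical
  intro z
  let A : (Z → X) → (Z × Z → Z) → Finset X := fun w π => Finset.univ.image fun i => w (π (z i))
  have hA : ∀ w π, (A w π).card ≤ M := fun w π => Finset.card_image_le.trans (by simp)
  have hmem : ∀ w π i, w (π (z i)) ∈ A w π := fun w π i =>
    Finset.mem_image_of_mem _ (Finset.mem_univ i)
  let P := (A u Prod.fst ∪ A v Prod.fst) ∪ (A u Prod.snd ∪ A v Prod.snd)
  have hP : P.card ≤ 4 * M := by
    refine (Finset.card_union_le _ _).trans ?_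
    have h2 := Finset.card_union_le (A u Prod.fst) (A v Prod.fst)
    have h3 := Finset.card_union_le (A u Prod.snd) (A v Prod.snd)
    have := hA u Prod.fst
    have := hA v Prod.fst
    have := hA u Prod.snd
    have := hA v Prod.snd
    omega
  -- The grid size `K = M` gives error `k (1 / M + 1 / M)`, at the at most `4 M` images of the pairs
  -- under `u` and `v`.
  obtain ⟨s, hs, hcov⟩ := exists_cover_of_vcDimLE hf hV P hM
  refine ⟨s, hs.trans (Nat.pow_le_pow_left (Nat.succ_le_succ (Nat.mul_le_mul_right _ hP)) V),
    fun θ => ?_⟩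
  obtain ⟨θ', hθ', hc⟩ := hcov θ
  have key : ∀ q, u q ∈ P → v q ∈ P → |H q θ - H q θ'| ≤ 2 * k / M := by
    intro q hu hv
    refine (hH q θ θ').trans ?_
    have := mul_le_mul_of_nonneg_left (add_le_add (hc _ hu) (hc _ hv)) hk
    refine this.trans (le_of_eq ?_)
    ring
  refine ⟨θ', hθ', fun i => ⟨key _ ?_ ?_, key _ ?_ ?_⟩⟩
  · exact Finset.mem_union_left _ (Finset.mem_union_left _ (hmem u Prod.fst i))
  · exact Finset.mem_union_left _ (Finset.mem_union_right _ (hmem v Prod.fst i))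
  · exact Finset.mem_union_right _ (Finset.mem_union_left _ (hmem u Prod.snd i))
  · exact Finset.mem_union_right _ (Finset.mem_union_right _ (hmem v Prod.snd i))

/-! ### Convex duality -/

/-- Lagrange multipliers for a convex problem with a strictly feasible point. -/
theorem exists_lagrange_multipliers {E ι : Type*} [AddCommGroup E] [Module ℝ E] [Fintype ι]
    {F : Set E} {R : E → ℝ} {c : ι → E → ℝ} (hR : ConvexOn ℝ F R) (hc : ∀ k, ConvexOn ℝ F (c k))
    {f₀ : E} (hf₀ : f₀ ∈ F) (hslater : ∀ k, c k f₀ < 0) {p : ℝ}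
    (hp : ∀ f ∈ F, (∀ k, c k f ≤ 0) → p ≤ R f) :
    ∃ l : ι → ℝ, (∀ k, 0 ≤ l k) ∧ ∀ f ∈ F, p ≤ R f + ∑ k, l k * c k f := by
  classical
  -- Strict domination makes `A` open without any continuity of `R` or `c`; it is then separated
  -- from `(0, p)` by Hahn-Banach.
  let A : Set ((ι → ℝ) × ℝ) := {y | ∃ f ∈ F, (∀ k, c k f < y.1 k) ∧ R f < y.2}
  have hAo : IsOpen A := by
    have : A = ⋃ f ∈ F, {y : (ι → ℝ) × ℝ | (∀ k, c k f < y.1 k) ∧ R f < y.2} := by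
      ext y
      simp only [A, mem_ofPred_eq, mem_iUnion, exists_prop]
    rw [this]
    refine isOpen_biUnion fun f _ => ?_
    have h1 : IsOpen {y : (ι → ℝ) × ℝ | ∀ k, c k f < y.1 k} := by
      rw [ofPred_forall]
      exact isOpen_iInter_of_finite fun k => isOpen_lt continuous_const (by fun_prop)
    exact h1.inter (isOpen_lt continuous_const continuous_snd)
  have hAc : Convex ℝ A := by
    rintro x ⟨f, hf, hfc, hfR⟩ y ⟨g, hg, hgc, hgR⟩ a b ha hb hab
    have key : ∀ s t s' t' : ℝ, s < s' → t < t' → a * s + b * t < a * s' + b * t' := by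
      intro s t s' t' h1 h2
      rcases ha.eq_or_lt with rfl | ha'
      · have : b = 1 := by linarith
        subst this
        linarith
      · have := mul_lt_mul_of_pos_left h1 ha'
        have := mul_le_mul_of_nonneg_left h2.le hb
        linarith
    refine ⟨a • f + b • g, hR.1 hf hg ha hb hab, fun k => ?_, ?_⟩
    · exact ((hc k).2 hf hg ha hb hab).trans_lt (key _ _ _ _ (hfc k) (hgc k))
    · exact (hR.2 hf hg ha hb hab).trans_lt (key _ _ _ _ hfR hgR)
  have hpA : ((0 : ι → ℝ), p) ∉ A := by
    rintro ⟨f, hf, hfc, hfR⟩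
    exact absurd (hp f hf fun k => (hfc k).le) (not_le.2 hfR)
  obtain ⟨φ, hφ⟩ := geometric_hahn_banach_open_point hAc hAo hpA
  set μ : ι → ℝ := fun k => φ (Pi.single k 1, 0) with hμ
  set μ₀ : ℝ := φ (0, 1) with hμ₀
  have hφeq : ∀ u r, φ (u, r) = ∑ k, u k * μ k + r * μ₀ := by
    intro u r
    have h1 : ((u, r) : (ι → ℝ) × ℝ) =
        ∑ k, u k • ((Pi.single k 1, 0) : (ι → ℝ) × ℝ) + r • ((0, 1) : (ι → ℝ) × ℝ) := by
      ext k
      · simp [Prod.fst_sum, Finset.sum_apply, Pi.single_apply]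
      · simp [Prod.snd_sum]
    rw [h1, map_add, map_sum, map_smul]
    simp only [map_smul, smul_eq_mul, hμ, hμ₀]
  have hlt : ∀ f ∈ F, ∀ u : ι → ℝ, ∀ r, (∀ k, c k f < u k) → R f < r →
      ∑ k, u k * μ k + r * μ₀ < p * μ₀ := by
    intro f hf u r hu hr
    have := hφ (u, r) ⟨f, hf, hu, hr⟩
    rw [hφeq, hφeq] at this
    simpa using this
  have nonpos : ∀ S m T : ℝ, (∀ s : ℝ, 0 ≤ s → S + s * m < T) → m ≤ 0 := by
    intro S m T h
    by_contra! hm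
    have h1 := h (|T - S| / m) (by positivity)
    rw [div_mul_cancel₀ _ hm.ne'] at h1
    linarith [le_abs_self (T - S)]
  have hμ₀le : μ₀ ≤ 0 := by
    refine nonpos ((R f₀ + 1) * μ₀) μ₀ (p * μ₀) fun s hs => ?_
    have := hlt f₀ hf₀ 0 (R f₀ + 1 + s) hslater (by linarith)
    simp only [Pi.zero_apply, zero_mul, Finset.sum_const_zero, zero_add] at this
    linarith
  -- Slater's condition excludes a vertical hyperplane: with `μ₀ = 0`, the point `f₀` at constraint
  -- levels 0 would give `0 < 0`.
  have hμ₀lt : μ₀ < 0 := by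
    refine hμ₀le.lt_of_ne fun h0 => ?_
    have := hlt f₀ hf₀ 0 (R f₀ + 1) hslater (by linarith)
    simp [h0] at this
  have hμle : ∀ k, μ k ≤ 0 := by
    intro k
    refine nonpos ((R f₀ + 1) * μ₀) (μ k) (p * μ₀) fun s hs => ?_
    have := hlt f₀ hf₀ (Pi.single k s) (R f₀ + 1) (fun j => (hslater j).trans_le ?_) (by linarith)
    · simp only [Pi.single_apply, ite_mul, zero_mul, Finset.sum_ite_eq', Finset.mem_univ,
        if_true] at this
      linarith
    · rw [Pi.single_apply]
      split_ifs
      exacts [hs, le_rfl]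
  refine ⟨fun k => μ k / μ₀, fun k => div_nonneg_of_nonpos (hμle k) hμ₀le, fun f hf => ?_⟩
  have hle : ∑ k, c k f * μ k + R f * μ₀ ≤ p * μ₀ := by
    by_contra! hcon
    set m := ∑ k, μ k + μ₀ with hm
    have hm0 : m < 0 := by
      have := Finset.sum_nonpos (s := Finset.univ) fun k _ => hμle k
      linarith
    -- The shift that would turn the reversed inequality into equality, against the strict
    -- separation.
    set ε := (p * μ₀ - (∑ k, c k f * μ k + R f * μ₀)) / m with hε
    have hε0 : 0 < ε := div_pos_of_neg_of_neg (by linarith) hm0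
    have h1 := hlt f hf (fun k => c k f + ε) (R f + ε) (fun k => by linarith) (by linarith)
    have h2 : ∑ k, (c k f + ε) * μ k + (R f + ε) * μ₀ =
        ∑ k, c k f * μ k + R f * μ₀ + ε * m := by
      simp only [add_mul, Finset.sum_add_distrib, hm, mul_add, Finset.mul_sum]
      ring
    rw [h2, hε, div_mul_cancel₀ _ hm0.ne] at h1
    linarith
  have h3 : (R f + ∑ k, μ k / μ₀ * c k f) * μ₀ = ∑ k, c k f * μ k + R f * μ₀ := by
    rw [add_mul, Finset.sum_mul, add_comm]
    congr 1
    refine Finset.sum_congr rfl fun k _ => ?_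
    rw [mul_right_comm, div_mul_cancel₀ _ hμ₀lt.ne, mul_comm]
  rw [← h3] at hle
  exact (mul_le_mul_right_of_neg hμ₀lt).1 hle

/-! ### Rate of uniform deviations -/

/-- A constant controlling the deviations, at confidence `ω`, of classes of VC dimension `V` with
envelope `b` and Lipschitz constant `k`. -/
theorem exists_deviation_rate (V : ℕ) {b k η ω : ℝ} (hb : 0 < b) (hk : 0 ≤ k) (hη : 0 < η)
    (hω : 0 < ω) :
    ∃ c : ℝ, ∃ M₀ : ℕ, ∀ M : ℕ, M₀ ≤ M →
      0 < M ∧ 0 < c * √(Real.log M / M) ∧ 8 * (2 * k / M) ≤ c * √(Real.log M / M) ∧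
      8 * b ^ 2 ≤ M * (c * √(Real.log M / M)) ^ 2 ∧
      4 * (((4 * M * M + 1) ^ V : ℕ) *
        Real.exp (-(M * (c * √(Real.log M / M)) ^ 2 / (128 * b ^ 2)))) ≤ ω ∧
      c * √(Real.log M / M) ≤ η := by
  -- The term `16 k` dominates the discretization error, as `1 / M ≤ √(log M / M)` once `log M ≥ 1`.
  -- The other gives `c² ≥ 128 b² (3 V + 1)`, so the exponential is at most `M ^ (-(3 V + 1))` and
  -- beats the cover size, at most `M ^ (3 V)` for `M ≥ 5`, leaving `4 / M`.
  set c : ℝ := 16 * k + 12 * b * (3 * V + 1) with hc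
  have hV0 : (0 : ℝ) ≤ V := Nat.cast_nonneg V
  have hc12 : 12 * b * (3 * V + 1) ≤ c := by linarith
  have hc0 : 0 < c := lt_of_lt_of_le (by positivity) hc12
  have hlim : Filter.Tendsto (fun M : ℕ => c * √(Real.log M / M)) Filter.atTop (nhds 0) := by
    have h1 : Filter.Tendsto (fun x : ℝ => Real.log x / x) Filter.atTop (nhds 0) := by
      simpa using Real.tendsto_pow_log_div_mul_add_atTop 1 0 1 one_ne_zero
    have h2 := (Real.continuous_sqrt.tendsto 0).comp (h1.comp tendsto_natCast_atTop_atTop)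
    simpa using h2.const_mul c
  have hev : ∀ᶠ M : ℕ in Filter.atTop, 5 ≤ M ∧ 4 / ω ≤ (M : ℝ) ∧ c * √(Real.log M / M) < η ∧
      1 ≤ Real.log M := by
    refine (Filter.eventually_ge_atTop 5).and ((tendsto_natCast_atTop_atTop.eventually_ge_atTop
      (4 / ω)).and ((hlim.eventually_lt_const hη).and ?_))
    exact (Real.tendsto_log_atTop.comp tendsto_natCast_atTop_atTop).eventually_ge_atTop 1
  obtain ⟨M₀, hM₀⟩ := Filter.eventually_atTop.1 hev
  refine ⟨c, M₀, fun M hM => ?_⟩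
  obtain ⟨h5, hMω, hη', hlog⟩ := hM₀ M hM
  have hMpos : 0 < M := by omega
  have hM' : (0 : ℝ) < M := by exact_mod_cast hMpos
  have hM1 : (1 : ℝ) ≤ M := by exact_mod_cast hMpos
  have hsq : M * (c * √(Real.log M / M)) ^ 2 = c ^ 2 * Real.log M := by
    rw [mul_pow, Real.sq_sqrt (by positivity)]
    field_simp
  have hcsq : 128 * b ^ 2 * (3 * V + 1) ≤ c ^ 2 := by
    have h1 : (12 * b * (3 * V + 1)) ^ 2 ≤ c ^ 2 := pow_le_pow_left₀ (by positivity) hc12 2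
    have h2 : (0 : ℝ) ≤ b ^ 2 * (3 * V + 1) := by positivity
    have h3 : b ^ 2 * (3 * V + 1) ≤ b ^ 2 * (3 * V + 1) * (3 * V + 1) :=
      le_mul_of_one_le_right h2 (by linarith)
    linarith
  refine ⟨hMpos, by positivity, ?_, ?_, ?_, hη'.le⟩
  · have h1 : (1 : ℝ) / M ≤ √(Real.log M / M) := by
      refine Real.le_sqrt_of_sq_le ?_
      rw [div_pow, one_pow, div_le_div_iff₀ (by positivity) hM']
      have h2 := mul_le_mul hM1 hlog zero_le_one hM'.le
      have h3 := mul_le_mul_of_nonneg_left h2 hM'.le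
      linarith
    have h4 : 16 * k * (1 / M) ≤ c * √(Real.log M / M) :=
      mul_le_mul (by rw [hc]; linarith [show 0 ≤ 12 * b * (3 * V + 1) by positivity]) h1
        (by positivity) hc0.le
    refine le_trans (le_of_eq ?_) h4
    ring
  · rw [hsq]
    have h1 : b ^ 2 ≤ b ^ 2 * (3 * V + 1) := le_mul_of_one_le_right (sq_nonneg b) (by linarith)
    have h2 : c ^ 2 ≤ c ^ 2 * Real.log M := le_mul_of_one_le_right (sq_nonneg c) hlog
    linarith [sq_nonneg b]
  · have hG : (((4 * M * M + 1) ^ V : ℕ) : ℝ) ≤ (M : ℝ) ^ (3 * V) := by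
      have h1 : 4 * M * M + 1 ≤ M ^ 3 := by
        have h2 : 5 * (M * M) ≤ M * (M * M) := Nat.mul_le_mul_right _ h5
        have h3 : 1 ≤ M * M := Nat.mul_pos hMpos hMpos
        calc 4 * M * M + 1 = 4 * (M * M) + 1 := by ring
          _ ≤ 5 * (M * M) := by omega
          _ ≤ M * (M * M) := h2
          _ = M ^ 3 := by ring
      rw [pow_mul]
      exact_mod_cast Nat.pow_le_pow_left h1 V
    have hE : Real.exp (-(M * (c * √(Real.log M / M)) ^ 2 / (128 * b ^ 2))) ≤
        ((M : ℝ) ^ (3 * V + 1))⁻¹ := by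
      have h1 : ((3 * V + 1 : ℕ) : ℝ) * Real.log M ≤
          M * (c * √(Real.log M / M)) ^ 2 / (128 * b ^ 2) := by
        rw [hsq, le_div_iff₀ (by positivity)]
        push_cast
        have := mul_le_mul_of_nonneg_right hcsq (zero_le_one.trans hlog)
        linarith
      refine (Real.exp_le_exp.2 (neg_le_neg h1)).trans (le_of_eq ?_)
      rw [Real.exp_neg, Real.exp_nat_mul, Real.exp_log hM']
    calc 4 * ((((4 * M * M + 1) ^ V : ℕ) : ℝ) *
          Real.exp (-(M * (c * √(Real.log M / M)) ^ 2 / (128 * b ^ 2))))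
        ≤ 4 * ((M : ℝ) ^ (3 * V) * ((M : ℝ) ^ (3 * V + 1))⁻¹) := by
          gcongr
      _ = 4 / M := by
          rw [pow_succ]
          field_simp
      _ ≤ ω := by
          rw [div_le_iff₀ hω] at hMω
          rw [div_le_iff₀ hM']
          linarith

/-- Uniform deviations over finitely many functionals of a VC class, each under one domain. -/
theorem sampleLaw_exists_deviation_le {n : ℕ} {X Θ J : Type*} [MeasurableSpace X]
    [StandardBorelSpace X] [MeasurableSpace Θ] [StandardBorelSpace Θ] [Fintype J]
    {D : FairDG n X Θ} (hP : ∀ s, IsProbabilityMeasure (D.P s))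
    (hf : ∀ x θ, D.fhat x θ ∈ Icc (0 : ℝ) 1) {V : ℕ} (hV : VCDimLE D.paramClass V)
    (dom : J → Fin n) {H : J → Datum X → Θ → ℝ}
    (hH : ∀ j, Measurable fun q : Datum X × Θ => H j q.1 q.2) {b k : ℝ} (hb : 0 < b) (hk : 0 ≤ k)
    (hHb : ∀ j q θ, |H j q θ| ≤ b) (u v : J → Datum X → X)
    (hHk : ∀ j q θ θ', |H j q θ - H j q θ'| ≤
      k * (|D.fhat (u j q) θ - D.fhat (u j q) θ'| + |D.fhat (v j q) θ - D.fhat (v j q) θ'|))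
    {M : ℕ} (hM : 0 < M) {t ω : ℝ} (ht : 0 < t) (hkt : 8 * (2 * k / M) ≤ t)
    (hbt : 8 * b ^ 2 ≤ M * t ^ 2)
    (hω : 4 * (((4 * M * M + 1) ^ V : ℕ) * Real.exp (-(M * t ^ 2 / (128 * b ^ 2)))) ≤ ω) :
    D.sampleLaw M {S | ∃ j θ, t < |1 / (M : ℝ) * ∑ m, H j (S (dom j) m) θ -
      ∫ q, H j q θ ∂(D.P (dom j))|} ≤ Fintype.card J * ENNReal.ofReal ω := by
  have hsub : {S : Fin n → Fin M → Datum X | ∃ j θ, t < |1 / (M : ℝ) * ∑ m, H j (S (dom j) m) θ -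
      ∫ q, H j q θ ∂(D.P (dom j))|} ⊆ ⋃ j, Function.eval (dom j) ⁻¹'
        {x : Fin M → Datum X | ∃ θ, t < |1 / (M : ℝ) * ∑ m, H j (x m) θ -
          ∫ q, H j q θ ∂(D.P (dom j))|} := by
    rintro S ⟨j, θ, h⟩
    exact mem_iUnion.2 ⟨j, θ, h⟩
  refine (measure_mono hsub).trans ((measure_iUnion_fintype_le _ _).trans ?_)
  have hone : ∀ j ∈ (Finset.univ : Finset J), D.sampleLaw M (Function.eval (dom j) ⁻¹'
        {x : Fin M → Datum X | ∃ θ, t < |1 / (M : ℝ) * ∑ m, H j (x m) θ -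
          ∫ q, H j q θ ∂(D.P (dom j))|}) ≤ ENNReal.ofReal ω := by
    intro j _
    have hev := measurePreserving_eval (fun s => Measure.pi fun _ : Fin M => D.P s) (dom j)
    -- This inequality holds for arbitrary sets, so measurability of the event is not needed.
    refine (Measure.le_map_apply hev.aemeasurable _).trans ?_
    rw [hev.map_eq]
    refine (measure_exists_deviation_le (D.P (dom j)) (hH j) hb (hHb j) hM ht hkt hbt
      (pairCover_of_vcDimLE hf hV hk (u j) (v j) (hHk j) hM)).trans ?_
    exact ENNReal.ofReal_le_ofReal hω
  refine (Finset.sum_le_sum hone).trans (le_of_eq ?_)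
  simp

/-! ### Regularity, convexity and approximation of the functionals -/

/-- The loss is controlled only on `[0, 1]`, so the composition factors through that subtype, where
each label gives a continuous function. -/
theorem measurable_loss_comp {Z : Type*} [MeasurableSpace Z] {loss : ℝ → Lab → ℝ} {Lℓ : ℝ}
    (hL : ∀ a ∈ Icc (0 : ℝ) 1, ∀ b ∈ Icc (0 : ℝ) 1, ∀ y, |loss a y - loss b y| ≤ Lℓ * |a - b|)
    {a : Z → ℝ} (ha : Measurable a) (ha1 : ∀ q, a q ∈ Icc (0 : ℝ) 1) {y : Z → Lab}
    (hy : Measurable y) : Measurable fun q => loss (a q) (y q) := by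
  have h1 : ∀ y, Continuous fun r : Icc (0 : ℝ) 1 => loss r y := by
    intro y
    refine (LipschitzWith.of_dist_le_mul (K := Real.toNNReal Lℓ) fun r s => ?_).continuous
    refine (hL r r.2 s s.2 y).trans ?_
    exact mul_le_mul_of_nonneg_right (Real.le_coe_toNNReal Lℓ) (abs_nonneg _)
  have h2 : Measurable fun q : Icc (0 : ℝ) 1 × Lab => loss q.1 q.2 :=
    measurable_from_prod_countable_left fun y => (h1 y).measurable
  exact h2.comp ((ha.subtype_mk (h := ha1)).prodMk hy)

theorem measurable_fairG_comp {Z : Type*} [MeasurableSpace Z] (p : ℝ)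
    {a : Z → ℝ} (ha : Measurable a) {z : Z → Sens} (hz : Measurable z) :
    Measurable fun q => fairG p (a q) (z q) := by
  have h1 : Measurable fun q => ((z q : ℤ) : ℝ) :=
    (measurable_of_countable (fun s : Sens => ((s : ℤ) : ℝ))).comp hz
  unfold fairG
  exact ((((h1.add_const 1).div_const 2).sub_const p).const_mul _).mul ha

/-- Integration of functionals that are convex pointwise. -/
theorem convexOn_integral {X Z : Type*} [MeasurableSpace Z] (μ : Measure Z) {F : Set (X → ℝ)}
    {Φ : (X → ℝ) → Z → ℝ} (hF : Convex ℝ F) (hint : ∀ f ∈ F, Integrable (Φ f) μ)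
    (hΦ : ∀ f ∈ F, ∀ g ∈ F, ∀ a b : ℝ, 0 ≤ a → 0 ≤ b → a + b = 1 → ∀ q,
      Φ (a • f + b • g) q ≤ a * Φ f q + b * Φ g q) :
    ConvexOn ℝ F fun f => ∫ q, Φ f q ∂μ := by
  refine ⟨hF, fun f hf g hg a b ha hb hab => ?_⟩
  rw [smul_eq_mul, smul_eq_mul, ← integral_const_mul, ← integral_const_mul,
    ← integral_add ((hint f hf).const_mul a) ((hint g hg).const_mul b)]
  exact integral_mono (hint _ (hF hf hg ha hb hab))
    (((hint f hf).const_mul a).add ((hint g hg).const_mul b)) (hΦ f hf g hg a b ha hb hab)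

theorem abs_integral_sub_integral_le {Z : Type*} [MeasurableSpace Z] {μ : Measure Z}
    {g h φ : Z → ℝ} (hg : Integrable g μ) (hh : Integrable h μ) (hφ : Integrable φ μ) {K ξ : ℝ}
    (hK : 0 ≤ K) (hgh : ∀ q, |g q - h q| ≤ K * φ q) (hξ : ∫ q, φ q ∂μ ≤ ξ) :
    |∫ q, g q ∂μ - ∫ q, h q ∂μ| ≤ K * ξ := by
  rw [← integral_sub hg hh]
  refine (abs_integral_le_integral_abs).trans ?_
  refine (integral_mono (hg.sub hh).abs (hφ.const_mul K) hgh).trans ?_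
  rw [integral_const_mul]
  exact mul_le_mul_of_nonneg_left hξ hK

namespace FairDG

variable {n : ℕ} {X Θ : Type*} [MeasurableSpace X] [MeasurableSpace Θ] {D : FairDG n X Θ}

theorem Wellposed.fhat_mem (hW : D.Wellposed) (θ : Θ) : (fun x => D.fhat x θ) ∈ D.F :=
  hW.param_subset ⟨θ, rfl⟩

theorem Wellposed.pos (hW : D.Wellposed) : 0 < n := by
  rcases Nat.eq_zero_or_pos n with rfl | h
  · simpa using hW.weights.2
  · exact h

theorem Wellposed.measurable_transform (hW : D.Wellposed) (j : Fin n) :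
    Measurable fun q : Datum X => (D.T q.1 q.2.1 j).1 :=
  measurable_fst.comp ((hW.measurable_T j).comp
    (measurable_fst.prodMk (measurable_fst.comp measurable_snd)))

theorem integrable_loss {f : X → ℝ} (hf : f ∈ D.F)
    {B Lℓ : ℝ} (hW : D.Wellposed) (hL : D.LossAssumption B Lℓ) (s : Fin n) :
    Integrable (fun q : Datum X => D.loss (f q.1) q.2.2) (D.P s) := by
  have := hW.prob s
  refine Integrable.of_bound (measurable_loss_comp hL.lipschitz
    ((hW.measurable_F f hf).comp measurable_fst) (fun q => hW.range_F f hf _)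
    (measurable_snd.comp measurable_snd)).aestronglyMeasurable B (ae_of_all _ fun q => ?_)
  have h := hL.bounded (f q.1) (hW.range_F f hf _) q.2.2
  rw [Real.norm_eq_abs, abs_of_nonneg h.1]
  exact h.2

theorem integrable_dist {f : X → ℝ} (hf : f ∈ D.F)
    {B Ld : ℝ} (hW : D.Wellposed) (hd : D.DistAssumption B Ld) (i j : Fin n) :
    Integrable (fun q : Datum X => D.d (f q.1) (f (D.T q.1 q.2.1 j).1)) (D.P i) := by
  have := hW.prob i
  have hm := hW.measurable_F f hf
  refine Integrable.of_bound (hW.measurable_d.comp ((hm.comp measurable_fst).prodMk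
    (hm.comp (hW.measurable_transform j)))).aestronglyMeasurable B (ae_of_all _ fun q => ?_)
  have h := hd.bounded (f q.1) (hW.range_F f hf _) (f (D.T q.1 q.2.1 j).1) (hW.range_F f hf _)
  rw [Real.norm_eq_abs, abs_of_nonneg h.1]
  exact h.2

theorem integrable_fairG {f : X → ℝ} (hf : f ∈ D.F)
    {B Lg : ℝ} (hW : D.Wellposed) (hg : D.FairAssumption B Lg) (s : Fin n) :
    Integrable (fun q : Datum X => fairG (D.p₁ s) (f q.1) q.2.1) (D.P s) := by
  have := hW.prob s
  exact Integrable.of_bound (measurable_fairG_comp _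
    ((hW.measurable_F f hf).comp measurable_fst)
    (measurable_fst.comp measurable_snd)).aestronglyMeasurable B
    (ae_of_all _ fun q => hg.bounded s _ (hW.range_F f hf _) _)

theorem R_nonneg {f : X → ℝ} (hf : f ∈ D.F)
    {B Lℓ : ℝ} (hW : D.Wellposed) (hL : D.LossAssumption B Lℓ) : 0 ≤ D.R f :=
  Finset.sum_nonneg fun s _ => mul_nonneg (hW.weights.1 s)
    (integral_nonneg fun _ => (hL.bounded _ (hW.range_F f hf _) _).1)

theorem δ_nonneg {f : X → ℝ} (hf : f ∈ D.F)
    {B Ld : ℝ} (hW : D.Wellposed) (hd : D.DistAssumption B Ld) (i j : Fin n) :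
    0 ≤ D.δ f i j :=
  integral_nonneg fun _ => (hd.bounded _ (hW.range_F f hf _) _ (hW.range_F f hf _)).1

/-- A nonnegative integrand has zero integral only if it vanishes almost surely, and `d` vanishes
only on equal predictions. This places the exact problem at the origin of the perturbation function.
-/
theorem invariant_iff_feasible_zero {f : X → ℝ} (hf : f ∈ D.F)
    {B Ld : ℝ} (hW : D.Wellposed) (hd : D.DistAssumption B Ld) :
    D.Invariant f ↔ D.Feasible 0 0 f := by
  refine forall_congr' fun i => forall_congr' fun j => imp_congr_right fun _ => ?_
  have h1 : (∀ᵐ q ∂(D.P i), f q.1 = f (D.T q.1 q.2.1 j).1) ↔ D.δ f i j ≤ 0 := by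
    have h0 : ∀ q : Datum X, 0 ≤ D.d (f q.1) (f (D.T q.1 q.2.1 j).1) := fun q =>
      (hd.bounded _ (hW.range_F f hf _) _ (hW.range_F f hf _)).1
    have hz := integral_eq_zero_iff_of_nonneg h0 (integrable_dist hf hW hd i j)
    rw [(δ_nonneg hf hW hd i j).ge_iff_eq', δ, hz]
    exact Filter.eventually_congr (ae_of_all _ fun q =>
      (hd.eq_zero_iff _ (hW.range_F f hf _) _ (hW.range_F f hf _)).symm)
  have h2 : 0 ≤ D.ρ f i := abs_nonneg _
  have h3 : 0 ≤ D.ρ f j := abs_nonneg _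
  refine and_congr h1 ⟨fun h => by rw [h.1, h.2, add_zero], fun h => ⟨?_, ?_⟩⟩ <;> linarith

theorem Pstar_eq_pert {B Ld : ℝ} (hW : D.Wellposed) (hd : D.DistAssumption B Ld) :
    D.Pstar = D.pert 0 0 := by
  unfold Pstar pert
  refine iInf_congr fun f => iInf_congr fun hf => ?_
  rw [invariant_iff_feasible_zero hf hW hd]

theorem convexOn_R {B Lℓ : ℝ} (hW : D.Wellposed) (hL : D.LossAssumption B Lℓ) :
    ConvexOn ℝ D.F D.R := by
  have h : ∀ s, ConvexOn ℝ D.F fun f => ∫ q, D.loss (f q.1) q.2.2 ∂(D.P s) := fun s =>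
    convexOn_integral _ hW.convex_F (fun f hf => integrable_loss hf hW hL s)
      fun f hf g hg _ _ ha hb hab q => (hL.convex q.2.2).2 (hW.range_F f hf _) (hW.range_F g hg _)
        ha hb hab
  refine ⟨hW.convex_F, fun f hf g hg a b ha hb hab => ?_⟩
  simp only [R, smul_eq_mul, Finset.mul_sum, ← Finset.sum_add_distrib]
  refine Finset.sum_le_sum fun s _ => ?_
  have h1 := mul_le_mul_of_nonneg_left ((h s).2 hf hg ha hb hab) (hW.weights.1 s)
  simp only [smul_eq_mul] at h1
  linarith

theorem convexOn_δ {B Ld : ℝ} (hW : D.Wellposed) (hd : D.DistAssumption B Ld) (i j : Fin n) :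
    ConvexOn ℝ D.F fun f => D.δ f i j :=
  convexOn_integral _ hW.convex_F (fun _ hf => integrable_dist hf hW hd i j)
    fun f hf g hg _ _ ha hb hab q => hd.convex.2
      (x := (f q.1, f (D.T q.1 q.2.1 j).1)) (y := (g q.1, g (D.T q.1 q.2.1 j).1))
      ⟨hW.range_F f hf _, hW.range_F f hf _⟩ ⟨hW.range_F g hg _, hW.range_F g hg _⟩ ha hb hab

theorem convexOn_ρ {B Lg : ℝ} (hW : D.Wellposed) (hg : D.FairAssumption B Lg) (s : Fin n) :
    ConvexOn ℝ D.F fun f => D.ρ f s := by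
  refine ⟨hW.convex_F, fun f hf g hg' a b ha hb hab => ?_⟩
  have hf' := integrable_fairG hf hW hg s
  have hg'' := integrable_fairG hg' hW hg s
  have h1 : ∫ q, fairG (D.p₁ s) ((a • f + b • g) q.1) q.2.1 ∂(D.P s) =
      a * ∫ q, fairG (D.p₁ s) (f q.1) q.2.1 ∂(D.P s) +
        b * ∫ q, fairG (D.p₁ s) (g q.1) q.2.1 ∂(D.P s) := by
    rw [← integral_const_mul, ← integral_const_mul,
      ← integral_add (hf'.const_mul a) (hg''.const_mul b)]
    refine integral_congr_ae (ae_of_all _ fun q => ?_)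
    simp only [fairG, Pi.add_apply, Pi.smul_apply, smul_eq_mul]
    ring
  simp only [ρ, h1, smul_eq_mul]
  refine (abs_add_le _ _).trans ?_
  rw [abs_mul, abs_mul, abs_of_nonneg ha, abs_of_nonneg hb]

theorem exists_param_approx {B Lℓ Ld Lg ξ : ℝ} (hLℓ : 0 ≤ Lℓ) (hLd : 0 ≤ Ld) (hLg : 0 ≤ Lg)
    (hW : D.Wellposed) (hL : D.LossAssumption B Lℓ) (hd : D.DistAssumption B Ld)
    (hg : D.FairAssumption B Lg) (hp : D.IsParameterization ξ) {f : X → ℝ} (hf : f ∈ D.F) :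
    ∃ θ : Θ, D.R (fun x => D.fhat x θ) ≤ D.R f + Lℓ * ξ ∧
      (∀ i j, i ≠ j → D.δ (fun x => D.fhat x θ) i j ≤ D.δ f i j + Ld * ξ) ∧
      ∀ s, D.ρ (fun x => D.fhat x θ) s ≤ D.ρ f s + Lg * ξ := by
  obtain ⟨θ, hθ⟩ := hp f hf
  have hF := hW.fhat_mem θ
  have hφ : ∀ s, Integrable (fun q : Datum X => |D.fhat q.1 θ - f q.1|) (D.P s) := by
    intro s
    have := hW.prob s
    have hm : Measurable fun q : Datum X => D.fhat q.1 θ - f q.1 :=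
      ((hW.measurable_F _ hF).comp measurable_fst).sub
        ((hW.measurable_F f hf).comp measurable_fst)
    refine (Integrable.of_bound hm.aestronglyMeasurable 1 (ae_of_all _ fun q => ?_)).abs
    have h1 := hW.range_F _ hF q.1
    have h2 := hW.range_F f hf q.1
    rw [Real.norm_eq_abs, abs_le]
    constructor <;> linarith [h1.1, h1.2, h2.1, h2.2]
  refine ⟨θ, ?_, fun i j hij => ?_, fun s => ?_⟩
  · have h1 : ∀ s, ∫ q, D.loss (D.fhat q.1 θ) q.2.2 ∂(D.P s) ≤
        ∫ q, D.loss (f q.1) q.2.2 ∂(D.P s) + Lℓ * ξ := by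
      intro s
      have := abs_integral_sub_integral_le (integrable_loss hF hW hL s) (integrable_loss hf hW hL s)
        (hφ s) hLℓ (fun q => hL.lipschitz _ (hW.range_F _ hF _) _ (hW.range_F f hf _) _) (hθ s)
      linarith [le_abs_self (∫ q, D.loss (D.fhat q.1 θ) q.2.2 ∂(D.P s) -
        ∫ q, D.loss (f q.1) q.2.2 ∂(D.P s))]
    calc D.R (fun x => D.fhat x θ)
        ≤ ∑ s, D.w s * (∫ q, D.loss (f q.1) q.2.2 ∂(D.P s) + Lℓ * ξ) :=
          Finset.sum_le_sum fun s _ => mul_le_mul_of_nonneg_left (h1 s) (hW.weights.1 s)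
      _ = D.R f + Lℓ * ξ := by
          simp only [mul_add, Finset.sum_add_distrib, ← Finset.sum_mul, hW.weights.2, one_mul, R]
  -- The pointwise Lipschitz bound would involve errors at transformed points, where the
  -- parameterization gives no control; the bound in mean involves `P i` only.
  · have h1 := hd.lipschitz_mean _ hF f hf i j hij
    have h2 := mul_le_mul_of_nonneg_left (hθ i) hLd
    linarith [le_abs_self (D.δ (fun x => D.fhat x θ) i j - D.δ f i j)]
  · have h1 := abs_integral_sub_integral_le (integrable_fairG hF hW hg s)
      (integrable_fairG hf hW hg s) (hφ s) hLg
      (fun q => hg.lipschitz s _ (hW.range_F _ hF _) _ (hW.range_F f hf _) _) (hθ s)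
    have h2 := abs_sub_abs_le_abs_sub (∫ q, fairG (D.p₁ s) (D.fhat q.1 θ) q.2.1 ∂(D.P s))
      (∫ q, fairG (D.p₁ s) (f q.1) q.2.1 ∂(D.P s))
    unfold ρ
    linarith

end FairDG

/-! ### Comparison of Lagrangians -/

section Lagrangian

variable {n : ℕ} {l₁ l₂ : Fin n → Fin n → ℝ}

theorem dualNorm_eq (hl : DualNonneg l₁ l₂) : dualNorm l₁ l₂ =
    ∑ q ∈ (Finset.univ : Finset (Fin n)).offDiag, (l₁ q.1 q.2 + l₂ q.1 q.2) :=
  Finset.sum_congr rfl fun q _ => by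
    rw [abs_of_nonneg (hl q.1 q.2).1, abs_of_nonneg (hl q.1 q.2).2]

theorem dualNorm_nonneg (l₁ l₂ : Fin n → Fin n → ℝ) : 0 ≤ dualNorm l₁ l₂ :=
  Finset.sum_nonneg fun _ _ => add_nonneg (abs_nonneg _) (abs_nonneg _)

/-- As soon as there is a pair of distinct domains, the factor `1 / n` is at most `1 / 2`. -/
theorem two_div_mul_dualNorm_le (l₁ l₂ : Fin n → Fin n → ℝ) :
    1 / (n : ℝ) * (2 * dualNorm l₁ l₂) ≤ dualNorm l₁ l₂ := by
  rcases Nat.lt_or_ge n 2 with hn | hn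
  · have : dualNorm l₁ l₂ = 0 := by
      have : Subsingleton (Fin n) := Fin.subsingleton_iff_le_one.2 (by omega)
      refine Finset.sum_eq_zero fun q hq => absurd (Subsingleton.elim _ _) (Finset.mem_offDiag.1 hq).2.2
    simp [this]
  · have hn' : (2 : ℝ) ≤ n := by exact_mod_cast hn
    rw [one_div, inv_mul_le_iff₀ (by linarith)]
    exact mul_le_mul_of_nonneg_right hn' (dualNorm_nonneg _ _)

/-- The fairness constraints involve two domains and so cost `2 * α`; the factor `1 / n ≤ 1 / 2`
compensates, leaving `α` times the norm. -/
theorem lagr_le_lagr_add {R R' r α : ℝ} {δ δ' : Fin n → Fin n → ℝ} {ρ ρ' : Fin n → ℝ}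
    {γ₁ γ₂ γ₁' γ₂' : ℝ} (hl : DualNonneg l₁ l₂) (hα : 0 ≤ α) (hR : R ≤ R' + r)
    (hδ : ∀ i j, i ≠ j → δ i j - γ₁ ≤ δ' i j - γ₁' + α)
    (hρ : ∀ i j, i ≠ j → ρ i + ρ j - γ₂ ≤ ρ' i + ρ' j - γ₂' + 2 * α) :
    lagr R δ ρ γ₁ γ₂ l₁ l₂ ≤ lagr R' δ' ρ' γ₁' γ₂' l₁ l₂ + r + α * dualNorm l₁ l₂ := by
  have h1 : ∑ q ∈ (Finset.univ : Finset (Fin n)).offDiag,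
      (l₁ q.1 q.2 * (δ q.1 q.2 - γ₁) + l₂ q.1 q.2 * (ρ q.1 + ρ q.2 - γ₂)) ≤
      ∑ q ∈ (Finset.univ : Finset (Fin n)).offDiag,
      (l₁ q.1 q.2 * (δ' q.1 q.2 - γ₁') + l₂ q.1 q.2 * (ρ' q.1 + ρ' q.2 - γ₂')) +
      α * (2 * dualNorm l₁ l₂) := by
    rw [dualNorm_eq hl, Finset.mul_sum, Finset.mul_sum, ← Finset.sum_add_distrib]
    refine Finset.sum_le_sum fun q hq => ?_
    have hq' := (Finset.mem_offDiag.1 hq).2.2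
    have h2 := mul_le_mul_of_nonneg_left (hδ _ _ hq') (hl q.1 q.2).1
    have h3 := mul_le_mul_of_nonneg_left (hρ _ _ hq') (hl q.1 q.2).2
    have h4 := mul_nonneg hα (hl q.1 q.2).1
    linarith
  have h2 := mul_le_mul_of_nonneg_left h1 (by positivity : (0 : ℝ) ≤ 1 / n)
  have h3 := mul_le_mul_of_nonneg_left (two_div_mul_dualNorm_le l₁ l₂) hα
  unfold lagr
  linarith

/-- For `a > 0`, a lower bound on the Lagrangian at a point with slack `a` becomes an upper bound on
the norm of the multipliers. -/
theorem lagr_le_of_slack {R a : ℝ} {δ : Fin n → Fin n → ℝ} {ρ : Fin n → ℝ}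
    {γ₁ γ₂ : ℝ} (hl : DualNonneg l₁ l₂) (hδ : ∀ i j, i ≠ j → δ i j ≤ γ₁ - a)
    (hρ : ∀ i j, i ≠ j → ρ i + ρ j ≤ γ₂ - a) :
    lagr R δ ρ γ₁ γ₂ l₁ l₂ ≤ R - 1 / n * (a * dualNorm l₁ l₂) := by
  have h1 : ∑ q ∈ (Finset.univ : Finset (Fin n)).offDiag,
      (l₁ q.1 q.2 * (δ q.1 q.2 - γ₁) + l₂ q.1 q.2 * (ρ q.1 + ρ q.2 - γ₂)) ≤
      -(a * dualNorm l₁ l₂) := by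
    rw [dualNorm_eq hl, Finset.mul_sum, ← Finset.sum_neg_distrib]
    refine Finset.sum_le_sum fun q hq => ?_
    have hq' := (Finset.mem_offDiag.1 hq).2.2
    have h2 := mul_le_mul_of_nonneg_left (hδ _ _ hq') (hl q.1 q.2).1
    have h3 := mul_le_mul_of_nonneg_left (hρ _ _ hq') (hl q.1 q.2).2
    linarith
  have h2 := mul_le_mul_of_nonneg_left h1 (by positivity : (0 : ℝ) ≤ 1 / n)
  unfold lagr
  linarith

theorem lagr_le_of_feasible {R : ℝ} {δ : Fin n → Fin n → ℝ} {ρ : Fin n → ℝ}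
    {γ₁ γ₂ : ℝ} (hl : DualNonneg l₁ l₂)
    (h : ∀ i j, i ≠ j → δ i j ≤ γ₁ ∧ ρ i + ρ j ≤ γ₂) : lagr R δ ρ γ₁ γ₂ l₁ l₂ ≤ R := by
  have := lagr_le_of_slack (R := R) (a := 0) hl (fun i j hij => by simpa using (h i j hij).1)
    (fun i j hij => by simpa using (h i j hij).2)
  simpa using this

end Lagrangian

/-! ### Strong duality and the deterministic gap -/

namespace FairDG

variable {n : ℕ} {X Θ : Type*} [MeasurableSpace X] [MeasurableSpace Θ] {D : FairDG n X Θ}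

/-- Strong duality: a strictly feasible problem has multipliers. -/
theorem exists_dual_of_strictly_feasible {B Lℓ Ld Lg γ₁ γ₂ p : ℝ} (hW : D.Wellposed)
    (hL : D.LossAssumption B Lℓ) (hd : D.DistAssumption B Ld) (hg : D.FairAssumption B Lg)
    {f₀ : X → ℝ} (hf₀ : f₀ ∈ D.F)
    (hslater : ∀ i j, i ≠ j → D.δ f₀ i j < γ₁ ∧ D.ρ f₀ i + D.ρ f₀ j < γ₂)
    (hp : ∀ f ∈ D.F, D.Feasible γ₁ γ₂ f → p ≤ D.R f) :
    ∃ l₁ l₂, DualNonneg l₁ l₂ ∧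
      ∀ f ∈ D.F, p ≤ lagr (D.R f) (D.δ f) (D.ρ f) γ₁ γ₂ l₁ l₂ := by
  have hn : (0 : ℝ) < n := by exact_mod_cast hW.pos
  -- the constraints on the diagonal are vacuous
  let c : (Fin n × Fin n) ⊕ (Fin n × Fin n) → (X → ℝ) → ℝ := Sum.elim
    (fun q f => if q.1 = q.2 then -1 else D.δ f q.1 q.2 - γ₁)
    (fun q f => if q.1 = q.2 then -1 else D.ρ f q.1 + D.ρ f q.2 - γ₂)
  have hc : ∀ k, ConvexOn ℝ D.F (c k) := by
    rintro (⟨i, j⟩ | ⟨i, j⟩) <;> by_cases hij : i = j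
    · simpa [c, hij] using convexOn_const (-1 : ℝ) hW.convex_F
    · simp only [c, Sum.elim_inl, hij, if_false, sub_eq_add_neg]
      exact (convexOn_δ hW hd i j).add_const (-γ₁)
    · simpa [c, hij] using convexOn_const (-1 : ℝ) hW.convex_F
    · simp only [c, Sum.elim_inr, hij, if_false, sub_eq_add_neg]
      exact ((convexOn_ρ hW hg i).add (convexOn_ρ hW hg j)).add_const (-γ₂)
  obtain ⟨l, hl, hlf⟩ := exists_lagrange_multipliers (c := c) (p := p) (convexOn_R hW hL) hc hf₀
    (by
      rintro (⟨i, j⟩ | ⟨i, j⟩) <;> by_cases hij : i = j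
      · simp [c, hij]
      · simpa [c, hij] using (hslater i j hij).1
      · simp [c, hij]
      · simpa [c, hij] using (hslater i j hij).2)
    (fun f hf hfc => hp f hf fun i j hij => by
      have h1 := hfc (Sum.inl (i, j))
      have h2 := hfc (Sum.inr (i, j))
      simp only [c, Sum.elim_inl, Sum.elim_inr, hij, if_false] at h1 h2
      constructor <;> linarith)
  -- The factor `n` cancels the `1 / n` in `lagr`; diagonal terms contribute nonpositively and are
  -- dropped.
  refine ⟨fun i j => n * l (Sum.inl (i, j)), fun i j => n * l (Sum.inr (i, j)),
    fun i j => ⟨mul_nonneg hn.le (hl _), mul_nonneg hn.le (hl _)⟩, fun f hf => (hlf f hf).trans ?_⟩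
  unfold lagr
  refine add_le_add_right ?_ _
  rw [Fintype.sum_sum_type, ← Finset.sum_add_distrib, Finset.mul_sum,
    ← Finset.sum_sdiff (Finset.subset_univ (Finset.univ : Finset (Fin n)).offDiag)]
  have hdiag : ∑ q ∈ Finset.univ \ (Finset.univ : Finset (Fin n)).offDiag,
      (l (Sum.inl q) * c (Sum.inl q) f + l (Sum.inr q) * c (Sum.inr q) f) ≤ 0 := by
    refine Finset.sum_nonpos fun q hq => ?_
    have hq' : q.1 = q.2 := by simpa [Finset.mem_offDiag] using hq
    simp only [c, Sum.elim_inl, Sum.elim_inr, hq', if_true]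
    linarith [hl (Sum.inl q), hl (Sum.inr q)]
  refine (add_le_add_left hdiag _).trans (le_of_eq ?_)
  rw [zero_add]
  refine Finset.sum_congr rfl fun q hq => ?_
  have hq' : q.1 ≠ q.2 := (Finset.mem_offDiag.1 hq).2.2
  simp only [c, Sum.elim_inl, Sum.elim_inr, hq', if_false, Prod.mk.eta]
  field_simp

/-- A strictly feasible problem has an optimal dual variable. -/
theorem exists_isOptimalDual {B Lℓ Ld Lg γ₁ γ₂ : ℝ} (hW : D.Wellposed)
    (hL : D.LossAssumption B Lℓ) (hd : D.DistAssumption B Ld) (hg : D.FairAssumption B Lg)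
    {f₀ : X → ℝ} (hf₀ : f₀ ∈ D.F)
    (hslater : ∀ i j, i ≠ j → D.δ f₀ i j < γ₁ ∧ D.ρ f₀ i + D.ρ f₀ j < γ₂) :
    ∃ l₁ l₂, D.IsOptimalDual γ₁ γ₂ l₁ l₂ := by
  set A : Set ℝ := D.R '' {f | f ∈ D.F ∧ D.Feasible γ₁ γ₂ f} with hA
  have hAne : A.Nonempty :=
    ⟨_, f₀, ⟨hf₀, fun i j hij => ⟨(hslater i j hij).1.le, (hslater i j hij).2.le⟩⟩, rfl⟩
  have hAb : BddBelow A := by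
    refine ⟨0, ?_⟩
    rintro _ ⟨f, ⟨hf, -⟩, rfl⟩
    exact R_nonneg hf hW hL
  obtain ⟨l₁, l₂, hl, hlf⟩ := exists_dual_of_strictly_feasible (p := sInf A) hW hL hd hg hf₀ hslater
    fun f hf hff => csInf_le hAb ⟨f, ⟨hf, hff⟩, rfl⟩
  refine ⟨l₁, l₂, hl, fun m₁ m₂ hm => ?_⟩
  have h1 : ((sInf A : ℝ) : EReal) ≤ D.dualFun γ₁ γ₂ l₁ l₂ :=
    le_iInf₂ fun f hf => EReal.coe_le_coe_iff.2 (hlf f hf)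
  refine le_trans ?_ h1
  -- Weak duality: no dual value exceeds the primal infimum `sInf A`, which `l₁, l₂` reach.
  by_contra! hcon
  obtain ⟨r, hr1, hr2⟩ := EReal.lt_iff_exists_real_btwn.1 hcon
  refine absurd (EReal.coe_lt_coe_iff.1 hr1) (not_lt.2 (le_csInf hAne ?_))
  rintro _ ⟨f, ⟨hf, hff⟩, rfl⟩
  have h2 : (r : EReal) ≤ lagr (D.R f) (D.δ f) (D.ρ f) γ₁ γ₂ m₁ m₂ :=
    hr2.le.trans (iInf₂_le f hf)
  exact (EReal.coe_le_coe_iff.1 h2).trans (lagr_le_of_feasible hm hff)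

/-- The empirical risk and constraints are `t`-close to the true ones, uniformly. -/
def UniformlyClose {M : ℕ} (D : FairDG n X Θ) (S : Fin n → Fin M → Datum X) (t : ℝ) : Prop :=
  ∀ θ, |D.empR S θ - D.R (fun x => D.fhat x θ)| ≤ t ∧
    (∀ i j, |D.empδ S θ i j - D.δ (fun x => D.fhat x θ) i j| ≤ t) ∧
    ∀ s, |D.empρ S θ s - D.ρ (fun x => D.fhat x θ) s| ≤ t

section Gap

variable {B Lℓ Ld Lg ξ γ₁ γ₂ L k η b t : ℝ} {M : ℕ} {S : Fin n → Fin M → Datum X}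

theorem R_le (hW : D.Wellposed) (hL : D.LossAssumption B Lℓ) {f : X → ℝ} (hf : f ∈ D.F) :
    D.R f ≤ B := by
  have h1 : ∀ s, ∫ q, D.loss (f q.1) q.2.2 ∂(D.P s) ≤ B := fun s => by
    have := hW.prob s
    have h2 := integral_mono (integrable_loss hf hW hL s) (integrable_const B)
      fun q => (hL.bounded _ (hW.range_F f hf q.1) q.2.2).2
    simpa using h2
  calc D.R f ≤ ∑ s, D.w s * B :=
        Finset.sum_le_sum fun s _ => mul_le_mul_of_nonneg_left (h1 s) (hW.weights.1 s)
    _ = B := by rw [← Finset.sum_mul, hW.weights.2, one_mul]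

theorem empR_le (hW : D.Wellposed) (hL : D.LossAssumption B Lℓ) (S : Fin n → Fin M → Datum X)
    (θ : Θ) : D.empR S θ ≤ B := by
  have hB := hL.bounded 0 ⟨le_rfl, zero_le_one⟩ 0
  have h1 : ∀ s, 1 / (M : ℝ) * ∑ m, D.loss (D.fhat (S s m).1 θ) (S s m).2.2 ≤ B := fun s => by
    have h2 : ∑ m, D.loss (D.fhat (S s m).1 θ) (S s m).2.2 ≤ ∑ _m : Fin M, B :=
      Finset.sum_le_sum fun m _ =>
        (hL.bounded _ (hW.range_F _ (hW.fhat_mem θ) (S s m).1) (S s m).2.2).2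
    rw [Finset.sum_const, Finset.card_univ, Fintype.card_fin, nsmul_eq_mul] at h2
    calc 1 / (M : ℝ) * ∑ m, D.loss (D.fhat (S s m).1 θ) (S s m).2.2
        ≤ 1 / (M : ℝ) * (M * B) := mul_le_mul_of_nonneg_left h2 (by positivity)
      _ = (M : ℝ)⁻¹ * M * B := by ring
      _ ≤ B := mul_le_of_le_one_left (hB.1.trans hB.2) inv_mul_le_one
  calc D.empR S θ ≤ ∑ s, D.w s * B :=
        Finset.sum_le_sum fun s _ => mul_le_mul_of_nonneg_left (h1 s) (hW.weights.1 s)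
    _ = B := by rw [← Finset.sum_mul, hW.weights.2, one_mul]

theorem empDual_le (hξ : 0 ≤ ξ) (hLℓ : 0 ≤ Lℓ) (hLd : 0 ≤ Ld) (hLg : 0 ≤ Lg) (hη : 0 < η)
    (hkℓ : Lℓ ≤ k) (hkd : Ld ≤ k) (hkg : Lg ≤ k) (hb : 0 < b)
    (hBb : B ≤ b) (hW : D.Wellposed)
    (hL : D.LossAssumption B Lℓ) (hd : D.DistAssumption B Ld) (hg : D.FairAssumption B Lg)
    (hpar : D.IsParameterization ξ)
    {θ₀ : Θ} (hθ₀ : ∀ i j, i ≠ j → D.δ (fun x => D.fhat x θ₀) i j ≤ γ₁ - η ∧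
      D.ρ (fun x => D.fhat x θ₀) i + D.ρ (fun x => D.fhat x θ₀) j ≤ γ₂ - η)
    (hγ₁ : 0 ≤ γ₁) (hγ₂ : 0 ≤ γ₂)
    (ht : 0 ≤ t) (htη : t ≤ η / 4) (hS : D.UniformlyClose S t) {P : ℝ} (hP : D.pert 0 0 = P)
    {l₁ l₂ : Fin n → Fin n → ℝ} (hl : D.IsOptimalDual (γ₁ - ξ * k) (γ₂ - 2 * (ξ * k)) l₁ l₂) :
    D.empDual γ₁ γ₂ S ≤
      (P + ξ * k * (1 + dualNorm l₁ l₂) + (1 + 2 * n * b / η) * t : ℝ) := by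
  have hn : (0 : ℝ) < n := by exact_mod_cast hW.pos
  have hk : 0 ≤ k := hLℓ.trans hkℓ
  have hξk : 0 ≤ ξ * k := mul_nonneg hξ hk
  have hlP : ∀ r : ℝ, (∀ f ∈ D.F, D.Feasible 0 0 f → r ≤ D.R f) → r ≤ P := fun r h => by
    rw [← EReal.coe_le_coe_iff, ← hP]
    exact le_iInf₂ fun f hf => le_iInf fun hff => EReal.coe_le_coe_iff.2 (h f hf hff)
  have hP0 : 0 ≤ P := hlP 0 fun f hf _ => R_nonneg hf hW hL
  refine iSup₂_le fun m₁ m₂ => iSup_le fun hm => ?_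
  by_contra! hcon
  obtain ⟨r, hr1, hr2⟩ := EReal.lt_iff_exists_real_btwn.1 hcon
  rw [EReal.coe_lt_coe_iff] at hr1
  have hrθ : ∀ θ, r ≤ lagr (D.empR S θ) (D.empδ S θ) (D.empρ S θ) γ₁ γ₂ m₁ m₂ := fun θ =>
    EReal.coe_le_coe_iff.1 (hr2.le.trans (iInf_le _ θ))
  have hnorm := dualNorm_nonneg l₁ l₂
  have hr0 : 0 ≤ r := by
    have : 0 ≤ ξ * k * (1 + dualNorm l₁ l₂) + (1 + 2 * n * b / η) * t := by positivity
    linarith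
  -- strict feasibility bounds the dual variable
  have hmn : dualNorm m₁ m₂ ≤ 2 * n * b / η := by
    have h1 : lagr (D.empR S θ₀) (D.empδ S θ₀) (D.empρ S θ₀) γ₁ γ₂ m₁ m₂ ≤
        D.empR S θ₀ - 1 / n * (η / 2 * dualNorm m₁ m₂) := by
      -- The empirical slack is at least `η - 2 t ≥ η / 2`, since a sum of two fairness terms may
      -- err by `2 t`.
      refine lagr_le_of_slack hm (fun i j hij => ?_) fun i j hij => ?_
      · have := (abs_le.1 ((hS θ₀).2.1 i j)).2
        linarith [(hθ₀ i j hij).1]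
      · have := (abs_le.1 ((hS θ₀).2.2 i)).2
        have := (abs_le.1 ((hS θ₀).2.2 j)).2
        linarith [(hθ₀ i j hij).2]
    have h2 : D.empR S θ₀ ≤ b := (empR_le hW hL S θ₀).trans hBb
    have h3 : 1 / n * (η / 2 * dualNorm m₁ m₂) ≤ b := by linarith [hrθ θ₀]
    rw [le_div_iff₀ hη]
    rw [one_div, inv_mul_le_iff₀ hn] at h3
    linarith
  -- approximation by parameters
  have hdual : ∀ f ∈ D.F, r - (ξ * k + t) - t * dualNorm m₁ m₂ ≤
      lagr (D.R f) (D.δ f) (D.ρ f) (γ₁ - ξ * k) (γ₂ - 2 * (ξ * k)) m₁ m₂ := by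
    intro f hf
    obtain ⟨θ, hR, hδ, hρ⟩ := exists_param_approx hLℓ hLd hLg hW hL hd hg hpar hf
    have hkℓ' := mul_le_mul_of_nonneg_right hkℓ hξ
    have hkd' := mul_le_mul_of_nonneg_right hkd hξ
    have hkg' := mul_le_mul_of_nonneg_right hkg hξ
    -- The tightened levels absorb the approximation errors of the constraints, so only the sampling
    -- error `t` multiplies the norm of `m₁, m₂`.
    have h1 := lagr_le_lagr_add (R := D.empR S θ) (R' := D.R f) (r := ξ * k + t) (α := t)
      (δ := D.empδ S θ) (δ' := D.δ f) (ρ := D.empρ S θ) (ρ' := D.ρ f) (γ₁ := γ₁) (γ₂ := γ₂)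
      (γ₁' := γ₁ - ξ * k) (γ₂' := γ₂ - 2 * (ξ * k)) hm ht
      (by linarith [(abs_le.1 (hS θ).1).2])
      (fun i j hij => by linarith [(abs_le.1 ((hS θ).2.1 i j)).2, hδ i j hij])
      (fun i j hij => by
        linarith [(abs_le.1 ((hS θ).2.2 i)).2, (abs_le.1 ((hS θ).2.2 j)).2, hρ i, hρ j])
    linarith [hrθ θ]
  -- Optimality replaces the arbitrary multiplier by `l₁, l₂` before the levels are relaxed; hence
  -- `ξ * k` meets only the norm of the optimal dual variable.
  have hopt := hl.2 m₁ m₂ hm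
  have hdual' : ((r - (ξ * k + t) - t * dualNorm m₁ m₂ : ℝ) : EReal) ≤
      D.dualFun (γ₁ - ξ * k) (γ₂ - 2 * (ξ * k)) l₁ l₂ :=
    le_trans (le_iInf₂ fun f hf => EReal.coe_le_coe_iff.2 (hdual f hf)) hopt
  have hfin : r - (ξ * k + t) - t * dualNorm m₁ m₂ - ξ * k * dualNorm l₁ l₂ ≤ P := by
    refine hlP _ fun f hf hff => ?_
    have h1 := EReal.coe_le_coe_iff.1 (hdual'.trans (iInf₂_le f hf))
    have h2 := lagr_le_lagr_add (R := D.R f) (R' := D.R f) (r := 0) (α := ξ * k)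
      (δ := D.δ f) (δ' := D.δ f) (ρ := D.ρ f) (ρ' := D.ρ f) (γ₁ := γ₁ - ξ * k)
      (γ₂ := γ₂ - 2 * (ξ * k)) (γ₁' := γ₁) (γ₂' := γ₂) hl.1 hξk (by linarith)
      (fun i j _ => by linarith) (fun i j _ => by linarith)
    have h3 := lagr_le_of_feasible (R := D.R f) (γ₁ := γ₁) (γ₂ := γ₂) hl.1 fun i j hij =>
      ⟨(hff i j hij).1.trans hγ₁, (hff i j hij).2.trans hγ₂⟩
    linarith
  have h5 := mul_le_mul_of_nonneg_left hmn ht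
  linarith

/-- A multiplier of the true problem at levels `γ` is a competitor in the empirical dual. Strict
feasibility bounds its norm, hence the cost of sampling. -/
theorem le_empDual (hη : 0 < η) (hb : 0 < b) (hBb : B ≤ b) (hW : D.Wellposed)
    (hL : D.LossAssumption B Lℓ) (hd : D.DistAssumption B Ld) (hg : D.FairAssumption B Lg)
    {θ₀ : Θ} (hθ₀ : ∀ i j, i ≠ j → D.δ (fun x => D.fhat x θ₀) i j ≤ γ₁ - η ∧
      D.ρ (fun x => D.fhat x θ₀) i + D.ρ (fun x => D.fhat x θ₀) j ≤ γ₂ - η)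
    (ht : 0 ≤ t) (hS : D.UniformlyClose S t) {p : ℝ} (hp : D.pert γ₁ γ₂ = p) :
    ((p - (1 + 2 * n * b / η) * t : ℝ) : EReal) ≤ D.empDual γ₁ γ₂ S := by
  have hn : (0 : ℝ) < n := by exact_mod_cast hW.pos
  have hF₀ := hW.fhat_mem θ₀
  have hp0 : 0 ≤ p := by
    rw [← EReal.coe_le_coe_iff, ← hp]
    exact le_iInf₂ fun f hf => le_iInf fun _ => EReal.coe_le_coe_iff.2 (R_nonneg hf hW hL)
  obtain ⟨l₁, l₂, hl, hlf⟩ := exists_dual_of_strictly_feasible (p := p) hW hL hd hg hF₀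
    (fun i j hij => ⟨(hθ₀ i j hij).1.trans_lt (sub_lt_self _ hη),
      (hθ₀ i j hij).2.trans_lt (sub_lt_self _ hη)⟩)
    fun f hf hff => by
      rw [← EReal.coe_le_coe_iff, ← hp]
      exact (iInf₂_le f hf).trans (iInf_le _ hff)
  have hln : dualNorm l₁ l₂ ≤ 2 * n * b / η := by
    have h1 := lagr_le_of_slack (R := D.R fun x => D.fhat x θ₀) hl
      (fun i j hij => (hθ₀ i j hij).1) fun i j hij => (hθ₀ i j hij).2
    have h3 : 1 / n * (η * dualNorm l₁ l₂) ≤ b := by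
      linarith [hlf _ hF₀, R_le hW hL hF₀]
    rw [le_div_iff₀ hη]
    rw [one_div, inv_mul_le_iff₀ hn] at h3
    linarith [mul_pos hn hb]
  refine le_trans ?_ (le_iSup₂_of_le l₁ l₂ (le_iSup_of_le hl le_rfl))
  refine le_iInf fun θ => EReal.coe_le_coe_iff.2 ?_
  have h1 := lagr_le_lagr_add (R := D.R fun x => D.fhat x θ) (R' := D.empR S θ) (r := t) (α := t)
    (δ := D.δ fun x => D.fhat x θ) (δ' := D.empδ S θ) (ρ := D.ρ fun x => D.fhat x θ)
    (ρ' := D.empρ S θ) (γ₁ := γ₁) (γ₂ := γ₂) (γ₁' := γ₁) (γ₂' := γ₂) hl ht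
    (by linarith [(abs_le.1 (hS θ).1).1])
    (fun i j _ => by linarith [(abs_le.1 ((hS θ).2.1 i j)).1])
    (fun i j _ => by linarith [(abs_le.1 ((hS θ).2.2 i)).1, (abs_le.1 ((hS θ).2.2 j)).1])
  have h2 := hlf _ (hW.fhat_mem θ)
  have h5 := mul_le_mul_of_nonneg_left hln ht
  linarith

theorem gapAtMost_of_uniformlyClose (hξ : 0 ≤ ξ) (hLℓ : 0 ≤ Lℓ) (hLd : 0 ≤ Ld) (hLg : 0 ≤ Lg)
    (hη : 0 < η) (hkℓ : Lℓ ≤ k) (hkd : Ld ≤ k) (hkg : Lg ≤ k) (hb : 0 < b) (hBb : B ≤ b)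
    (hW : D.Wellposed) (hL : D.LossAssumption B Lℓ) (hd : D.DistAssumption B Ld)
    (hg : D.FairAssumption B Lg) (hpar : D.IsParameterization ξ)
    {θ₀ : Θ} (hθ₀ : ∀ i j, i ≠ j → D.δ (fun x => D.fhat x θ₀) i j ≤ γ₁ - η ∧
      D.ρ (fun x => D.fhat x θ₀) i + D.ρ (fun x => D.fhat x θ₀) j ≤ γ₂ - η)
    (hγ₁ : 0 ≤ γ₁) (hγ₂ : 0 ≤ γ₂) (hLip : D.PertLipschitz L)
    (ht : 0 ≤ t) (htη : t ≤ η / 4) (hS : D.UniformlyClose S t)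
    {l₁ l₂ : Fin n → Fin n → ℝ} (hl : D.IsOptimalDual (γ₁ - ξ * k) (γ₂ - 2 * (ξ * k)) l₁ l₂) :
    GapAtMost D.Pstar (D.empDual γ₁ γ₂ S)
      (L * (|γ₁| + |γ₂|) + ξ * k * (1 + dualNorm l₁ l₂) + (1 + 2 * n * b / η) * t) := by
  obtain ⟨p, hp, hpL⟩ := hLip
  have hup := empDual_le hξ hLℓ hLd hLg hη hkℓ hkd hkg hb hBb hW hL hd hg hpar hθ₀ hγ₁ hγ₂ ht htη hS
    (hp 0 0 le_rfl le_rfl) hl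
  have hlo := le_empDual hη hb hBb hW hL hd hg hθ₀ ht hS (hp γ₁ γ₂ hγ₁ hγ₂)
  have hLp := hpL γ₁ γ₂ 0 0 hγ₁ hγ₂ le_rfl le_rfl
  rw [sub_zero, sub_zero] at hLp
  have hfin : ((D.empDual γ₁ γ₂ S).toReal : EReal) = D.empDual γ₁ γ₂ S :=
    EReal.coe_toReal (ne_top_of_le_ne_top (EReal.coe_ne_top _) hup)
      (ne_bot_of_le_ne_bot (EReal.coe_ne_bot _) hlo)
  rw [← hfin, EReal.coe_le_coe_iff] at hup hlo
  refine ⟨p 0 0, (D.empDual γ₁ γ₂ S).toReal, ?_, hfin.symm, ?_⟩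
  · rw [Pstar_eq_pert hW hd, hp 0 0 le_rfl le_rfl]
  · have h1 : 0 ≤ ξ * k * (1 + dualNorm l₁ l₂) := by
      have := dualNorm_nonneg l₁ l₂
      have : 0 ≤ k := hLℓ.trans hkℓ
      positivity
    have h2 := abs_le.1 hLp
    have h3 := (abs_nonneg _).trans hLp
    rw [abs_le]
    constructor <;> linarith [h2.1, h2.2]

end Gap

/-! ### Probability of uniform closeness and conclusion -/

theorem sampleLaw_not_uniformlyClose_le [StandardBorelSpace X] [StandardBorelSpace Θ]
    {B Lℓ Ld Lg k b : ℝ} (hLℓ : 0 ≤ Lℓ) (hkℓ : Lℓ ≤ k) (hkd : Ld ≤ k) (hkg : Lg ≤ k) (hb : 0 < b)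
    (hBb : B ≤ b) (hW : D.Wellposed) (hL : D.LossAssumption B Lℓ) (hd : D.DistAssumption B Ld)
    (hg : D.FairAssumption B Lg) {V : ℕ} (hV : VCDimLE D.paramClass V) {M : ℕ} (hM : 0 < M)
    {t ω : ℝ} (ht : 0 < t) (hkt : 8 * (2 * k / M) ≤ t) (hbt : 8 * b ^ 2 ≤ M * t ^ 2)
    (hω : 4 * (((4 * M * M + 1) ^ V : ℕ) * Real.exp (-(M * t ^ 2 / (128 * b ^ 2)))) ≤ ω) :
    D.sampleLaw M {S | ¬ D.UniformlyClose S t} ≤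
      Fintype.card (Fin n ⊕ (Fin n × Fin n) ⊕ Fin n) * ENNReal.ofReal ω := by
  have hf : ∀ x θ, D.fhat x θ ∈ Icc (0 : ℝ) 1 := fun x θ => hW.range_F _ (hW.fhat_mem θ) x
  have hk : 0 ≤ k := hLℓ.trans hkℓ
  have hm : Measurable fun w : Datum X × Θ => D.fhat w.1.1 w.2 :=
    hW.measurable_fhat.comp ((measurable_fst.comp measurable_fst).prodMk measurable_snd)
  have hmT : ∀ j, Measurable fun w : Datum X × Θ => D.fhat (D.T w.1.1 w.1.2.1 j).1 w.2 := fun j =>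
    hW.measurable_fhat.comp
      (((hW.measurable_transform j).comp measurable_fst).prodMk measurable_snd)
  let dom : Fin n ⊕ (Fin n × Fin n) ⊕ Fin n → Fin n := Sum.elim id (Sum.elim Prod.fst id)
  let H : Fin n ⊕ (Fin n × Fin n) ⊕ Fin n → Datum X → Θ → ℝ := Sum.elim
    (fun _ q θ => D.loss (D.fhat q.1 θ) q.2.2) (Sum.elim
      (fun ij q θ => D.d (D.fhat q.1 θ) (D.fhat (D.T q.1 q.2.1 ij.2).1 θ))
      (fun s q θ => fairG (D.p₁ s) (D.fhat q.1 θ) q.2.1))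
  -- Only the distance looks at a second, transformed point; elsewhere the first point is repeated.
  let v : Fin n ⊕ (Fin n × Fin n) ⊕ Fin n → Datum X → X := Sum.elim (fun _ => Prod.fst)
    (Sum.elim (fun ij q => (D.T q.1 q.2.1 ij.2).1) (fun _ => Prod.fst))
  have hmain := sampleLaw_exists_deviation_le (D := D) hW.prob hf hV dom (H := H) (k := k)
    (by
      rintro (s | ij | s)
      · exact measurable_loss_comp hL.lipschitz hm (fun w => hf _ _)
          (measurable_snd.comp (measurable_snd.comp measurable_fst))
      · exact hW.measurable_d.comp (hm.prodMk (hmT ij.2))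
      · exact measurable_fairG_comp _ hm (measurable_fst.comp (measurable_snd.comp measurable_fst)))
    hb hk
    (by
      rintro (s | ij | s) q θ
      · have h := hL.bounded _ (hf q.1 θ) q.2.2
        exact (abs_of_nonneg h.1).trans_le (h.2.trans hBb)
      · have h := hd.bounded _ (hf q.1 θ) _ (hf (D.T q.1 q.2.1 ij.2).1 θ)
        exact (abs_of_nonneg h.1).trans_le (h.2.trans hBb)
      · exact (hg.bounded s _ (hf q.1 θ) q.2.1).trans hBb)
    (fun _ => Prod.fst) v
    (by
      have key : ∀ {c x y : ℝ}, c ≤ k → 0 ≤ x → 0 ≤ y → c * x ≤ k * (x + y) := by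
        intro c x y hc hx hy
        have h1 := mul_le_mul_of_nonneg_right hc hx
        have h2 := mul_nonneg hk hy
        linarith
      rintro (s | ij | s) q θ θ'
      · exact (hL.lipschitz _ (hf _ _) _ (hf _ _) _).trans
          (key hkℓ (abs_nonneg _) (abs_nonneg _))
      · exact (hd.lipschitz _ (hW.fhat_mem θ) _ (hW.fhat_mem θ') _ _ _).trans
          (mul_le_mul_of_nonneg_right hkd (add_nonneg (abs_nonneg _) (abs_nonneg _)))
      · exact (hg.lipschitz s _ (hf _ _) _ (hf _ _) _).trans
          (key hkg (abs_nonneg _) (abs_nonneg _)))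
    hM ht hkt hbt hω
  refine (measure_mono fun S hS => ?_).trans hmain
  by_contra hcon
  simp only [mem_ofPred_eq, not_exists, not_lt] at hcon
  refine hS fun θ => ⟨?_, fun i j => hcon (Sum.inr (Sum.inl (i, j))) θ, fun s => ?_⟩
  · have h1 : ∀ s, |1 / (M : ℝ) * ∑ m, D.loss (D.fhat (S s m).1 θ) (S s m).2.2 -
        ∫ q, D.loss (D.fhat q.1 θ) q.2.2 ∂(D.P s)| ≤ t := fun s => hcon (Sum.inl s) θ
    unfold empR R
    rw [← Finset.sum_sub_distrib]
    calc |∑ s, (D.w s * (1 / (M : ℝ) * ∑ m, D.loss (D.fhat (S s m).1 θ) (S s m).2.2) -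
          D.w s * ∫ q, D.loss (D.fhat q.1 θ) q.2.2 ∂(D.P s))|
        ≤ ∑ s, D.w s * t := by
          refine (Finset.abs_sum_le_sum_abs _ _).trans (Finset.sum_le_sum fun s _ => ?_)
          rw [← mul_sub, abs_mul, abs_of_nonneg (hW.weights.1 s)]
          exact mul_le_mul_of_nonneg_left (h1 s) (hW.weights.1 s)
      _ = t := by rw [← Finset.sum_mul, hW.weights.2, one_mul]
  · exact (abs_abs_sub_abs_le _ _).trans (hcon (Sum.inr (Sum.inr s)) θ)

end FairDG

theorem theorem1 (n V : ℕ) (B Lℓ Ld Lg η ω : ℝ) (hLℓ : 0 < Lℓ) (hLd : 0 < Ld) (hLg : 0 < Lg)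
    (hη : 0 < η) (hω₀ : 0 < ω) (hω₁ : ω < 1) :
    -- the constants of the `O(√(log M / M))` term
    ∃ (C : ℝ) (M₀ : ℕ),
      ∀ (X Θ : Type*) [MeasurableSpace X] [StandardBorelSpace X]
        [MeasurableSpace Θ] [StandardBorelSpace Θ] (D : FairDG n X Θ) (ξ γ₁ γ₂ L k : ℝ),
        0 < ξ → 0 < γ₁ → 0 < γ₂ → k = max (max Lℓ Ld) Lg →
        D.Wellposed → D.LossAssumption B Lℓ → D.DistAssumption B Ld → D.FairAssumption B Lg →
        D.IsParameterization ξ → VCDimLE D.paramClass V →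
        D.StrictlyFeasible ξ Lℓ Ld Lg γ₁ γ₂ η → D.PertLipschitz L →
        -- optimal dual variables of the perturbed problem, in which each of the constraints
        -- `δ^{i,j} ≤ γ₁`, `ρ^i ≤ γ₂ / 2`, `ρ^j ≤ γ₂ / 2` is tightened by `ξ k`, exist as soon as
        -- that problem is strictly feasible
        ((∃ f ∈ D.F, ∀ i j, i ≠ j →
            D.δ f i j < γ₁ - ξ * k ∧ D.ρ f i + D.ρ f j < γ₂ - 2 * (ξ * k)) →
          ∃ l₁ l₂, D.IsOptimalDual (γ₁ - ξ * k) (γ₂ - 2 * (ξ * k)) l₁ l₂) ∧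
        -- and for each of them the gap is bounded with probability at least `1 - ω`
        ∀ l₁ l₂, D.IsOptimalDual (γ₁ - ξ * k) (γ₂ - 2 * (ξ * k)) l₁ l₂ →
          ∀ M : ℕ, M₀ ≤ M →
            D.sampleLaw M {S | ¬ GapAtMost D.Pstar (D.empDual γ₁ γ₂ S)
              (L * (|γ₁| + |γ₂|) + ξ * k * (1 + dualNorm l₁ l₂)
                + C * Real.sqrt (Real.log M / M))} ≤ ENNReal.ofReal ω := by
  set N : ℕ := Fintype.card (Fin n ⊕ (Fin n × Fin n) ⊕ Fin n) with hN
  have hb : 0 < max B 1 := lt_max_of_lt_right one_pos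
  have hk : 0 ≤ max (max Lℓ Ld) Lg := hLg.le.trans (le_max_right _ _)
  -- The target `η / 4` preserves half of the slack after sampling. The confidence is shared among
  -- the `N` functionals, with `N + 1` keeping the divisor positive when `n = 0`; `max B 1` likewise
  -- provides a positive envelope.
  obtain ⟨c, M₀, hrate⟩ := exists_deviation_rate V (η := η / 4) (ω := ω / (N + 1)) hb hk
    (by positivity) (by positivity)
  refine ⟨(1 + 2 * n * max B 1 / η) * c, M₀, ?_⟩
  intro X Θ _ _ _ _ D ξ γ₁ γ₂ L k hξ hγ₁ hγ₂ hkdef hW hL hd hg hpar hV hstrict hLip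
  have hkℓ : Lℓ ≤ k := hkdef ▸ (le_max_left _ _).trans (le_max_left _ _)
  have hkd : Ld ≤ k := hkdef ▸ (le_max_right _ _).trans (le_max_left _ _)
  have hkg : Lg ≤ k := hkdef ▸ le_max_right _ _
  refine ⟨fun ⟨f, hf, hslater⟩ => FairDG.exists_isOptimalDual hW hL hd hg hf hslater,
    fun l₁ l₂ hl M hM => ?_⟩
  obtain ⟨hM0, ht, hkt, hbt, hωt, htη⟩ := hrate M hM
  rw [← hkdef] at hkt
  obtain ⟨θ₀, hθ₀⟩ := hstrict
  have hθ₀' : ∀ i j, i ≠ j → D.δ (fun x => D.fhat x θ₀) i j ≤ γ₁ - η ∧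
      D.ρ (fun x => D.fhat x θ₀) i + D.ρ (fun x => D.fhat x θ₀) j ≤ γ₂ - η := by
    intro i j hij
    have h1 : 0 ≤ ξ * max Lℓ Ld := mul_nonneg hξ.le (hLd.le.trans (le_max_right _ _))
    have h2 : 0 ≤ ξ * max Lℓ Lg := mul_nonneg hξ.le (hLg.le.trans (le_max_right _ _))
    exact ⟨(hθ₀ i j hij).1.trans (by linarith), (hθ₀ i j hij).2.trans (by linarith)⟩
  refine (measure_mono ?_).trans ((FairDG.sampleLaw_not_uniformlyClose_le hLℓ.le hkℓ hkd hkg hb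
    (le_max_left _ _) hW hL hd hg hV hM0 ht hkt hbt hωt).trans ?_)
  · intro S hS hclose
    refine hS ?_
    rw [mul_assoc _ c]
    exact FairDG.gapAtMost_of_uniformlyClose hξ.le hLℓ.le hLd.le hLg.le hη hkℓ hkd hkg hb
      (le_max_left _ _) hW hL hd hg hpar hθ₀' hγ₁.le hγ₂.le hLip ht.le htη hclose hl
  · rw [← hN, ← ENNReal.ofReal_natCast, ← ENNReal.ofReal_mul (Nat.cast_nonneg N)]
    refine ENNReal.ofReal_le_ofReal ?_
    rw [mul_div_assoc', div_le_iff₀ (by positivity)]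
    linarith
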